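/- Let $q=3^r$ with $r\ge 1$. Let $\mathrm{tr}:\mathbb F_q\to\mathbb F_3$ be the trace, $\lambda(x)=e^{2\pi i\,\mathrm{tr}(x)/3}$, and for $a\in\mathbb F_q^*$ let $K(\lambda;a)=\sum_{\alpha\in\mathbb F_q^*}\lambda(\alpha+a\alpha^{-1})$. For integers $h\ge 0$ put $$SK^h=\sum_{a\in\mathbb F_q^*,\ a\text{ a square}}K(\lambda;a)^h .$$ Fix a nonsquare $\epsilon\in\mathbb F_q$. For $n\ge1$ let $J$ be the block diagonal matrix with diagonal blocks $\begin{pmatrix}0&1_{n-1}\\1_{n-1}&0\end{pmatrix}$ and $\begin{pmatrix}1&0\\0&-\epsilon\end{pmatrix}$, let $O^-(2n,q)=\{w\in GL(2n,q):{}^twJw=J\}$ and $SO^-(2n,q)=\{w\in O^-(2n,q):\det w=1\}$. For $G$ one of these groups, with its elements listed in any order $g_1,\dots,g_N$ ($N=|G|$), let $C(G)$ be the ternary linear code $\{u\in\mathbb F_3^N:\sum_i u_i\,\mathrm{Tr}(g_i)=0\}$ of length $N$. Its weight distribution is the sequence of the numbers of codewords of Hamming weight $j$, $0\le j\le N$;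 denote these numbers by $C_{1,j}$, $C_{2,j}$, $C_{3,j}$ for $G=SO^-(2,q)$, $O^-(2,q)$, $SO^-(4,q)$, respectively. For integers $a,b\ge0$ and $c\ge 0$ let $\binom{c}{a,b}=\frac{c!}{a!\,b!\,(c-a-b)!}$ if $a+b\le c$, and $\binom{c}{a,b}=0$ if $a+b>c$. Let $S(h,t)=\frac1{t!}\sum_{j=0}^t(-1)^{t-j}\binom tj j^h$. The ordinary binomial coefficient $\binom{n}{k}$ is $0$ for $k<0$. For a function $C$ of $j$ put $$W(N,h,C)=\sum_{j=0}^{\min\{N,h\}}(-1)^jC_j\sum_{t=j}^h t!\,S(h,t)\,3^{h-t}\,2^{t-h-j-1}\binom{N-j}{N-t}.$$ For $T\subseteq\mathbb F_q$ and nonnegative integers $n(\beta)$ $(\beta\in T)$ put $$\Sigma_j(T,n)=\sum\ \prod_{\beta\in T}\binom{n(\beta)}{\nu_\beta,\mu_\beta},$$ the sum being over all families $(\nu_\beta)_{\beta\in T}$, $(\mu_\beta)_{\beta\in T}$ of nonnegative integers with $\sum_\beta\nu_\beta+\sum_\beta\mu_\beta=j$ and $\sum_\beta\nu_\beta\beta=\sum_\beta\mu_\beta\beta$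 in $\mathbb F_q$. Let $D=\{\beta\in\mathbb F_q:\beta^2-1\text{ is a nonsquare}\}$ ($0$ counts as a square), and let $\delta(2,q;\beta)$ be the number of $(\alpha_1,\alpha_2)\in(\mathbb F_q^*)^2$ with $\alpha_1+\alpha_1^{-1}+\alpha_2+\alpha_2^{-1}=\beta$. (1) $N_1=|SO^-(2,q)|=q+1$. For all $h\ge1$, $$SK^h=-\sum_{j=0}^{h-1}\binom hj(q+1)^{h-j}SK^j+q\,W(N_1,h,C_{1,\cdot}).$$ For $0\le j\le N_1$, $C_{1,j}=\Sigma_j(\{1,-1\}\cup D,\,n)$ with $n(\pm1)=1$ and $n(\beta)=2$ for $\beta\in D$. (2) $N_2=|O^-(2,q)|=2(q+1)$. For all $h\ge1$, $$SK^h=-\sum_{j=0}^{h-1}\binom hj(q+1)^{h-j}SK^j+q\,W(N_2,h,C_{2,\cdot}).$$ (a) If $r$ is even, then for $0\le j\le N_2$, $C_{2,j}=\Sigma_j(\{0,1,-1\}\cup D,\,n)$ with $n(0)=q+1$, $n(\pm1)=1$ and $n(\beta)=2$ for $\beta\in D$. (b) If $r$ is odd, then for $0\le j\le N_2$, $C_{2,j}=\Sigma_j(\{0,1,-1\}\cup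 D',\,n)$, where $D'=\{\beta\in D:\beta^2-1\ne-1\}$, with $n(0)=q+3$, $n(\pm1)=1$ and $n(\beta)=2$ for $\beta\in D'$. (3) $N_3=|SO^-(4,q)|=q^2(q^4-1)$. For all $h\ge1$, $$SK^{2h}=-\sum_{j=0}^{h-1}\binom hj(q^4+q^3-q-1)^{h-j}SK^{2j}+q^{1-2h}\,W(N_3,h,C_{3,\cdot}).$$ For $0\le j\le N_3$, $C_{3,j}=\Sigma_j(\mathbb F_q,\,n)$, where $n(0)=-q^2\delta(2,q;0)+q^4+2q^3-3q^2$ and $n(\beta)=-q^2\delta(2,q;\beta)+q^5+q^4+q^3-3q^2$ for $\beta\ne0$; all these integers are nonnegative. -/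

import Mathlib

open Finset
open scoped BigOperators Nat Matrix

noncomputable section

/-! ## Kloosterman sums over a finite field of characteristic three -/

/-- The canonical additive character `x ↦ exp (2 π i tr(x) / 3)` of a finite field `F` of
characteristic three, `tr` being the trace from `F` to the prime field. -/
def canonicalChar (F : Type*) [Field F] [Algebra (ZMod 3) F] : AddChar F ℂ :=
  (ZMod.stdAddChar (N := 3)).compAddMonoidHom (Algebra.trace (ZMod 3) F).toAddMonoidHom

open Classical in
/-- The Kloosterman sum `K(ψ; a) = ∑_{α ≠ 0} ψ (α + a α⁻¹)`, for `a ≠ 0`. -/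
def kloosterman {F : Type*} [Field F] [Fintype F] (ψ : AddChar F ℂ) (a : Fˣ) : ℂ :=
  ∑ α : Fˣ, ψ ((α : F) + (a : F) * (α : F)⁻¹)

open Classical in
/-- `SK^h`: the `h`-th moment of the Kloosterman sums (for the canonical additive character)
with nonzero square arguments. -/
def squareMoment (F : Type*) [Field F] [Fintype F] [Algebra (ZMod 3) F] (h : ℕ) : ℂ :=
  ∑ a ∈ (Finset.univ : Finset Fˣ).filter fun a : Fˣ => IsSquare (a : F),
    kloosterman (canonicalChar F) a ^ h

/-! ## The orthogonal groups of minus type -/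

/-- The `2n` row and column indices (`n ≥ 1`), cut into blocks of sizes `n-1`, `n-1`, `2`. -/
abbrev MinusIndex (n : ℕ) : Type := (Fin (n - 1) ⊕ Fin (n - 1)) ⊕ Fin 2

/-- The matrix `J` of the quadratic form: a hyperbolic part of rank `2(n-1)`, followed by
`diag(1, -ε)`. -/
def minusForm {F : Type*} [Field F] (n : ℕ) (ε : F) :
    Matrix (MinusIndex n) (MinusIndex n) F :=
  Matrix.fromBlocks (Matrix.fromBlocks 0 1 1 0) 0 0 !![1, 0; 0, -ε]

/-- `O⁻(2n, q) = {w ∈ GL(2n, q) | ᵗw J w = J}`. -/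
def OMinus {F : Type*} [Field F] (n : ℕ) (ε : F) : Subgroup (GL (MinusIndex n) F) where
  carrier := {w | (w : Matrix (MinusIndex n) (MinusIndex n) F)ᵀ * minusForm n ε *
    (w : Matrix (MinusIndex n) (MinusIndex n) F) = minusForm n ε}
  one_mem' := by simp
  mul_mem' := by
    intro a b ha hb
    simp only [Set.mem_ofPred_eq] at ha hb ⊢
    rw [Units.val_mul, Matrix.transpose_mul]
    calc _ = (b : Matrix (MinusIndex n) (MinusIndex n) F)ᵀ *
          ((a : Matrix (MinusIndex n) (MinusIndex n) F)ᵀ * minusForm n ε *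
            (a : Matrix (MinusIndex n) (MinusIndex n) F)) *
          (b : Matrix (MinusIndex n) (MinusIndex n) F) := by simp only [Matrix.mul_assoc]
      _ = _ := by rw [ha, hb]
  inv_mem' := by
    intro a ha
    simp only [Set.mem_ofPred_eq] at ha ⊢
    have h1 : (a : Matrix (MinusIndex n) (MinusIndex n) F) *
        ((a⁻¹ : GL (MinusIndex n) F) : Matrix (MinusIndex n) (MinusIndex n) F) = 1 := by
      rw [← Units.val_mul, mul_inv_cancel, Units.val_one]
    have h2 : ((a⁻¹ : GL (MinusIndex n) F) : Matrix (MinusIndex n) (MinusIndex n) F)ᵀ *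
        (a : Matrix (MinusIndex n) (MinusIndex n) F)ᵀ = 1 := by
      rw [← Matrix.transpose_mul, h1, Matrix.transpose_one]
    generalize ((a⁻¹ : GL (MinusIndex n) F) : Matrix (MinusIndex n) (MinusIndex n) F) = b at h1 h2 ⊢
    calc bᵀ * minusForm n ε * b
        = bᵀ * ((a : Matrix (MinusIndex n) (MinusIndex n) F)ᵀ * minusForm n ε *
            (a : Matrix (MinusIndex n) (MinusIndex n) F)) * b := by rw [ha]
      _ = (bᵀ * (a : Matrix (MinusIndex n) (MinusIndex n) F)ᵀ) * minusForm n ε *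
            ((a : Matrix (MinusIndex n) (MinusIndex n) F) * b) := by
          simp only [Matrix.mul_assoc]
      _ = minusForm n ε := by rw [h1, h2, one_mul, mul_one]

/-- `SO⁻(2n, q) = {w ∈ O⁻(2n, q) | det w = 1}`. -/
def SOMinus {F : Type*} [Field F] (n : ℕ) (ε : F) : Subgroup (GL (MinusIndex n) F) :=
  OMinus n ε ⊓ (Matrix.GeneralLinearGroup.det (n := MinusIndex n) (R := F)).ker

/-! ## The ternary codes and their weight distributions -/

/-- The ternary linear code of all `u ∈ 𝔽₃^N` with `u · v = 0`, where `v ∈ F^N` is the vector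
`(Tr g₁, …, Tr g_N)` of the traces of a list of invertible matrices. -/
def traceCode {F : Type*} [Field F] [Algebra (ZMod 3) F] {m : Type*} [Fintype m]
    [DecidableEq m] {N : ℕ} (g : Fin N → GL m F) : Submodule (ZMod 3) (Fin N → ZMod 3) where
  carrier := {u | ∑ i, algebraMap (ZMod 3) F (u i) * Matrix.trace (g i : Matrix m m F) = 0}
  zero_mem' := by simp
  add_mem' := by
    intro a b ha hb
    simp only [Set.mem_ofPred_eq] at ha hb ⊢
    simp only [Pi.add_apply, map_add, add_mul, Finset.sum_add_distrib, ha, hb, add_zero]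
  smul_mem' := by
    intro c a ha
    simp only [Set.mem_ofPred_eq] at ha ⊢
    simp only [Pi.smul_apply, smul_eq_mul, map_mul, mul_assoc, ← Finset.mul_sum, ha, mul_zero]

/-- The code `C(G)` of a finite group `G` of matrices, the elements of `G` being listed in the
order `e`. -/
def groupCode {F : Type*} [Field F] [Algebra (ZMod 3) F] {m : Type*} [Fintype m]
    [DecidableEq m] (G : Subgroup (GL m F)) (e : Fin (Nat.card G) ≃ G) :
    Submodule (ZMod 3) (Fin (Nat.card G) → ZMod 3) :=
  traceCode fun i => (e i : GL m F)

/-- The number of codewords of Hamming weight `j`. -/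
def weightDist {N : ℕ} (C : Submodule (ZMod 3) (Fin N → ZMod 3)) (j : ℕ) : ℕ :=
  Nat.card {u : Fin N → ZMod 3 // u ∈ C ∧ hammingNorm u = j}

/-! ## The explicit sums -/

/-- `c! / (a! b! (c-a-b)!)` if `a + b ≤ c`, and `0` otherwise. -/
def trinomial (c : ℤ) (a b : ℕ) : ℕ :=
  if (a : ℤ) + b ≤ c then c.toNat ! / (a ! * b ! * (c.toNat - a - b)!) else 0

open Classical in
/-- `∑ ∏_{β ∈ T} trinomial (n β) (ν β) (μ β)` over all families `ν, μ` of nonnegative integers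
indexed by `T` with `∑ ν β + ∑ μ β = j` and, in `F`, `∑ ν β • β = ∑ μ β • β`.
(All the entries of such families are at most `j`.) -/
def trinomialSum {F : Type*} [Field F] (T : Finset F) (n : F → ℤ) (j : ℕ) : ℕ :=
  ∑ p ∈ (Fintype.piFinset fun _ : T => Finset.range (j + 1)) ×ˢ
        (Fintype.piFinset fun _ : T => Finset.range (j + 1)) with
      (∑ β : T, p.1 β + ∑ β : T, p.2 β = j ∧
        ∑ β : T, (p.1 β : F) * (β : F) = ∑ β : T, (p.2 β : F) * (β : F)),
    ∏ β : T, trinomial (n β) (p.1 β) (p.2 β)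

open Classical in
/-- The set of all `β` such that `β² - 1` is a nonsquare. -/
def nonsquareSet (F : Type*) [Field F] [Fintype F] : Finset F :=
  (Finset.univ : Finset F).filter fun β => ¬ IsSquare (β ^ 2 - 1)

/-- `δ(2, q; β)`: the number of pairs of nonzero `α₁, α₂` with
`α₁ + α₁⁻¹ + α₂ + α₂⁻¹ = β`. -/
def deltaTwo {F : Type*} [Field F] (β : F) : ℕ :=
  Nat.card {p : Fˣ × Fˣ // (p.1 : F) + (p.1 : F)⁻¹ + (p.2 : F) + (p.2 : F)⁻¹ = β}

open Classical in
/-- The upper entries of the multinomial coefficients for `SO⁻(4, q)`. -/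
def traceCountFour {F : Type*} [Field F] (q : ℕ) (β : F) : ℤ :=
  if β = 0 then -(q : ℤ) ^ 2 * deltaTwo (0 : F) + (q : ℤ) ^ 4 + 2 * (q : ℤ) ^ 3 - 3 * (q : ℤ) ^ 2
  else -(q : ℤ) ^ 2 * deltaTwo β + (q : ℤ) ^ 5 + (q : ℤ) ^ 4 + (q : ℤ) ^ 3 - 3 * (q : ℤ) ^ 2

/-- The Stirling number of the second kind
`S(h, t) = (1 / t!) ∑_{j=0}^{t} (-1)^{t-j} binom(t, j) j^h`. -/
def stirlingTwo (h t : ℕ) : ℂ :=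
  1 / (t ! : ℂ) * ∑ j ∈ Finset.range (t + 1), (-1) ^ (t - j) * (t.choose j : ℂ) * (j : ℂ) ^ h

/-- The binomial coefficient `binom(n, k)` for an integer `k`; it is `0` for `k < 0`. -/
def binomInt (n : ℕ) (k : ℤ) : ℕ := if 0 ≤ k then n.choose k.toNat else 0

/-- `∑_{j=0}^{min{N,h}} (-1)^j C_j ∑_{t=j}^{h} t! S(h,t) 3^{h-t} 2^{t-h-j-1} binom(N-j, N-t)`. -/
def weightSum (N h : ℕ) (C : ℕ → ℕ) : ℂ :=
  ∑ j ∈ Finset.range (min N h + 1), (-1) ^ j * (C j : ℂ) *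
    ∑ t ∈ Finset.Icc j h, (t ! : ℂ) * stirlingTwo h t * 3 ^ (h - t) *
      (2 : ℂ) ^ ((t : ℤ) - h - j - 1) * (binomInt (N - j) ((N : ℤ) - t) : ℂ)

end

/-! ### MacWilliams and Pless identities for trace codes. -/

section Coding

/-! For one of the groups G, attach to each a in F the word c(a) = (tr(a Tr g_1), ..., tr(a Tr
g_N)), with weight `traceWeight`. By orthogonality on the prime field, 3 wt c(a) = 2N - E(a) -
E(-a), where E(a) is the sum of λ(a Tr g) over G. For a ≠ 0 this sum turns out to be N - s(A +
K(λ;a²)^k) with explicit s, A, k. So wt c(a) = (2/3) s (A + K(λ;a²)^k), and, squaring being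
two-to-one onto the nonzero squares, the h-th power sum of the weights is a binomial combination of
the moments SK^{kj}, j ≤ h. Pless's identity `sum_traceWeight_pow` expresses the same power sum
through the weight distribution of C(G), whose defining equation is orthogonality to all c(a).
Solving for the top moment gives `squareMoment_recursion`. The sums run over a in F rather than over
the words c(a), so injectivity of a ↦ c(a) plays no role.

What remains is to count the elements of each trace. These counts give the orders of the groups, the
sums E(a), and the weight distributions (`card_orthogonal_words`).

In dimension 2 the rotations form the norm-one conic γ² - εb² = 1, with trace 2γ = -γ. Since ε is a
nonsquare, a trace β occurs 2 - δ(β) times, where δ(β) counts the solutions of α + α⁻¹ = β; this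
yields E(a) = -K(λ;a²). The q + 1 reflections all have trace 0.

In dimension 4 the elements of SO⁻ split according to whether they preserve an isotropic line ⟨e₀⟩
(`parabolicEquiv`) or lie in the big Bruhat cell (`bigCellEquiv`). The first part produces δ(2,q;β),
hence K². On the second the trace is a unit times a value of the anisotropic norm form, so its count
depends only on whether β = 0. -/

/-- Newton's expansion of powers in terms of binomial coefficients. -/
theorem natCast_pow_eq_sum_stirlingTwo (m h : ℕ) :
    (m : ℂ) ^ h = ∑ t ∈ range (h + 1), (t ! : ℂ) * stirlingTwo h t * (m.choose t : ℂ) := by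
  have hS : ∀ t, (t ! : ℂ) * stirlingTwo h t = (fwdDiff (1 : ℂ))^[t] (fun x : ℂ => x ^ h) 0 := by
    intro t
    rw [fwdDiff_iter_eq_sum_shift, stirlingTwo, ← mul_assoc, mul_one_div,
      div_self (by exact_mod_cast t.factorial_ne_zero), one_mul]
    refine Finset.sum_congr rfl fun k _ => ?_
    simp [zsmul_eq_mul]
  have h1 := shift_eq_sum_fwdDiff_iter (1 : ℂ) (fun x : ℂ => x ^ h) m 0
  simp only [nsmul_eq_mul, mul_one, zero_add, ← hS] at h1
  rw [h1]
  have hz : ∀ t, h < t → (t ! : ℂ) * stirlingTwo h t = 0 := by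
    intro t ht
    have := congr_fun (fwdDiff_iter_pow_eq_zero_of_lt (R := ℂ) ht) 0
    rw [hS]
    exact this
  -- Both sums extend to a common range: binom(m,t) vanishes for t > m, and the t-th difference of
  -- x^h vanishes for t > h.
  have e1 : ∀ n, max m h ≤ n → ∑ k ∈ range (m + 1), (m.choose k : ℂ) * ((k ! : ℂ) * stirlingTwo h k)
      = ∑ k ∈ range (n + 1), (m.choose k : ℂ) * ((k ! : ℂ) * stirlingTwo h k) := by
    intro n hn
    refine Finset.sum_subset (by intro x; simp only [Finset.mem_range]; omega) fun x _ hx => ?_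
    rw [Nat.choose_eq_zero_of_lt (by simpa using hx)]
    simp
  rw [e1 _ le_rfl]
  symm
  refine (Finset.sum_congr rfl fun x _ => mul_comm _ _).trans
    (Finset.sum_subset (by intro x; simp only [Finset.mem_range]; omega) fun x _ hx => ?_)
  rw [hz x (by simpa using hx)]
  simp

variable {F : Type*} [Field F] [Fintype F] [Algebra (ZMod 3) F]

omit [Fintype F] in
theorem canonicalChar_apply (x : F) :
    canonicalChar F x = ZMod.stdAddChar (N := 3) (Algebra.trace (ZMod 3) F x) := rfl

/-- The trace to the prime field is surjective, so the character is nontrivial. -/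
theorem isPrimitive_canonicalChar : (canonicalChar F).IsPrimitive := by
  apply AddChar.IsPrimitive.of_ne_one
  obtain ⟨x, hx⟩ := Algebra.trace_surjective (ZMod 3) F 1
  refine AddChar.ne_one_iff.2 ⟨x, fun h => ?_⟩
  rw [canonicalChar_apply, hx] at h
  have := ZMod.injective_stdAddChar (N := 3) (h.trans (AddChar.map_zero_eq_one _).symm)
  exact absurd this (by decide)

open Classical in
theorem sum_canonicalChar_mul (b : F) :
    ∑ a : F, canonicalChar F (a * b) = if b = 0 then (Fintype.card F : ℂ) else 0 := by
  rw [AddChar.sum_mulShift b isPrimitive_canonicalChar]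
  split_ifs <;> simp

theorem sum_stdAddChar_three_mul (x : ZMod 3) :
    ∑ s : ZMod 3, ZMod.stdAddChar (N := 3) (s * x) = if x = 0 then (3 : ℂ) else 0 := by
  rw [AddChar.sum_mulShift x (ZMod.isPrimitive_stdAddChar 3)]
  split_ifs <;> simp

theorem stdAddChar_sum {ι : Type*} (s : Finset ι) (g : ι → ZMod 3) :
    ZMod.stdAddChar (N := 3) (∑ i ∈ s, g i) = ∏ i ∈ s, ZMod.stdAddChar (N := 3) (g i) := by
  classical
  induction s using Finset.induction_on with
  | empty => simp
  | insert i s hi ih => rw [Finset.sum_insert hi, Finset.prod_insert hi, AddChar.map_add_eq_mul, ih]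

/-- The Hamming weight of the word `(tr (a v₁), …, tr (a v_N))`. -/
noncomputable def traceWeight {N : ℕ} (v : Fin N → F) (a : F) : ℕ :=
  hammingNorm fun i => Algebra.trace (ZMod 3) F (a * v i)

open Polynomial in
/-- The MacWilliams identity for the trace code of `v`. -/
theorem sum_one_add_X_pow_traceWeight {N : ℕ} (v : Fin N → F)
    (C' : Submodule (ZMod 3) (Fin N → ZMod 3))
    (hC : ∀ u, u ∈ C' ↔ ∑ i, algebraMap (ZMod 3) F (u i) * v i = 0) :
    ∑ a : F, (1 + X : ℂ[X]) ^ traceWeight v a =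
      C (Fintype.card F : ℂ) * ∑ j ∈ range (N + 1), (weightDist C' j : ℂ[X]) *
        ((1 + C (2 / 3) * X) ^ (N - j) * (C (-1 / 3) * X) ^ j) := by
  classical
  -- The function on the prime field whose Fourier transform is 1 at 0 and 1 + X elsewhere.
  -- Expanding the product over positions then turns (1 + X)^wt into a sum over all words u, and
  -- summing over a keeps only the u in the code.
  let f : ZMod 3 → ℂ[X] := fun s => if s = 0 then 1 + C (2 / 3) * X else C (-1 / 3) * X
  have hf : ∀ x : ZMod 3, (∑ s : ZMod 3, f s * C (ZMod.stdAddChar (N := 3) (s * x))) =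
      if x = 0 then 1 else 1 + X := by
    intro x
    have : ∀ s, f s * C (ZMod.stdAddChar (N := 3) (s * x)) =
        (if s = 0 then 1 + X else 0) + (C (-1 / 3) * X) * C (ZMod.stdAddChar (N := 3) (s * x)) := by
      intro s
      by_cases hs : s = 0
      · simp only [f, hs, if_true, zero_mul, AddChar.map_zero_eq_one, C_1, mul_one]
        rw [show (2 / 3 : ℂ) = 1 + -1 / 3 by norm_num, C_add, C_1]
        ring
      · simp [f, hs]
    simp only [this, Finset.sum_add_distrib, ← Finset.mul_sum, ← map_sum, sum_stdAddChar_three_mul]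
    by_cases hx : x = 0
    · simp only [hx, if_true, Finset.sum_ite_eq', Finset.mem_univ]
      rw [mul_right_comm, ← C_mul]
      norm_num
    · simp [hx]
  have hprod : ∀ a : F, (1 + X : ℂ[X]) ^ traceWeight v a =
      ∑ u : Fin N → ZMod 3, (∏ i, f (u i)) *
        C (canonicalChar F (a * ∑ i, algebraMap (ZMod 3) F (u i) * v i)) := by
    intro a
    have h1 : (1 + X : ℂ[X]) ^ traceWeight v a =
        ∏ i, if Algebra.trace (ZMod 3) F (a * v i) = 0 then (1 : ℂ[X]) else 1 + X := by
      rw [Finset.prod_ite, Finset.prod_const_one, one_mul, Finset.prod_const, traceWeight,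
        hammingNorm]
    rw [h1]
    simp only [← hf]
    rw [Finset.prod_univ_sum, Fintype.piFinset_univ]
    refine Finset.sum_congr rfl fun u _ => ?_
    rw [Finset.prod_mul_distrib, ← map_prod, canonicalChar_apply, Finset.mul_sum, map_sum,
      stdAddChar_sum]
    congr 2
    refine Finset.prod_congr rfl fun i _ => ?_
    congr 1
    rw [mul_left_comm, ← Algebra.smul_def, map_smul, smul_eq_mul]
  have hpf : ∀ u : Fin N → ZMod 3, ∏ i, f (u i) =
      (1 + C (2 / 3) * X) ^ (N - hammingNorm u) * (C (-1 / 3) * X) ^ hammingNorm u := by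
    intro u
    simp only [f]
    rw [Finset.prod_ite, Finset.prod_const, Finset.prod_const, hammingNorm]
    congr 2
    change _ = N - #{i | ¬ u i = 0}
    have := Finset.card_filter_add_card_filter_not (s := (univ : Finset (Fin N))) (fun i => u i = 0)
    simp only [Finset.card_univ, Fintype.card_fin] at this
    omega
  simp only [hprod]
  rw [Finset.sum_comm]
  have hsum : ∀ u : Fin N → ZMod 3, ∑ a : F, (∏ i, f (u i)) *
      C (canonicalChar F (a * ∑ i, algebraMap (ZMod 3) F (u i) * v i)) =
      (∏ i, f (u i)) * C (if u ∈ C' then (Fintype.card F : ℂ) else 0) := by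
    intro u
    rw [← Finset.mul_sum, ← map_sum, sum_canonicalChar_mul, if_congr (hC u).symm rfl rfl]
  simp only [hsum]
  have hw : ∀ j, (weightDist C' j : ℂ[X]) =
      ∑ u : Fin N → ZMod 3, if u ∈ C' ∧ hammingNorm u = j then 1 else 0 := by
    intro j
    rw [weightDist, Nat.card_eq_fintype_card, Fintype.card_subtype, Finset.sum_boole]
  simp only [hw, Finset.sum_mul]
  rw [Finset.sum_comm, Finset.mul_sum]
  refine Finset.sum_congr rfl fun u _ => ?_
  rw [hpf, Finset.sum_eq_single (hammingNorm u)]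
  · by_cases hu : u ∈ C'
    · rw [if_pos hu, if_pos ⟨hu, rfl⟩]
      ring
    · rw [if_neg hu, if_neg (fun h => hu h.1)]
      ring_nf
      simp
  · intro j _ hj
    simp [hj.symm]
  · intro h
    exact absurd (Finset.mem_range.2 (Nat.lt_succ_of_le
      (hammingNorm_le_card_fintype.trans (Fintype.card_fin N).le))) h

/-- The coefficient of X^t in the MacWilliams identity. -/
theorem sum_choose_traceWeight {N : ℕ} (v : Fin N → F)
    (C' : Submodule (ZMod 3) (Fin N → ZMod 3))
    (hC : ∀ u, u ∈ C' ↔ ∑ i, algebraMap (ZMod 3) F (u i) * v i = 0) (t : ℕ) :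
    ∑ a : F, ((traceWeight v a).choose t : ℂ) =
      (Fintype.card F : ℂ) * ∑ j ∈ range (N + 1), if j ≤ t then (-1) ^ j * (weightDist C' j : ℂ) *
        (2 ^ ((t : ℤ) - j) / 3 ^ t * (binomInt (N - j) ((N : ℤ) - t) : ℂ)) else 0 := by
  have h := congr_arg (fun p => Polynomial.coeff p t) (sum_one_add_X_pow_traceWeight v C' hC)
  simp only [Polynomial.finsetSum_coeff, Polynomial.coeff_one_add_X_pow,
    Polynomial.coeff_C_mul] at h
  rw [h]
  congr 1
  refine Finset.sum_congr rfl fun j hj => ?_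
  have hjN : j ≤ N := Nat.lt_succ_iff.1 (Finset.mem_range.1 hj)
  have hcomp : (1 + Polynomial.C (2 / 3 : ℂ) * Polynomial.X) ^ (N - j) =
      ((1 + Polynomial.X : Polynomial ℂ) ^ (N - j)).comp (Polynomial.C (2 / 3) * Polynomial.X) := by
    simp
  rw [← Polynomial.C_eq_natCast, Polynomial.coeff_C_mul, mul_pow, mul_left_comm, ← Polynomial.C_pow,
    Polynomial.coeff_C_mul, Polynomial.coeff_mul_X_pow', hcomp]
  split_ifs with hjt
  · rw [Polynomial.comp_C_mul_X_coeff, Polynomial.coeff_one_add_X_pow]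
    have hb : (binomInt (N - j) ((N : ℤ) - t) : ℂ) = ((N - j).choose (t - j) : ℂ) := by
      rw [binomInt]
      split_ifs with h0
      · have : ((N : ℤ) - t).toNat = N - t := by omega
        rw [this, ← Nat.choose_symm (n := N - j) (k := t - j) (by omega)]
        congr 2
        omega
      · rw [Nat.choose_eq_zero_of_lt (by omega)]
    rw [hb]
    have h2 : (2 : ℂ) ^ ((t : ℤ) - j) = 2 ^ (t - j) := by
      rw [← zpow_natCast, Nat.cast_sub hjt]
    have h3 : (3 : ℂ) ^ t = 3 ^ (t - j) * 3 ^ j := by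
      rw [← pow_add, Nat.sub_add_cancel hjt]
    rw [h2, h3, div_pow, div_pow]
    field_simp
  · simp

/-- Pless's power moment identity for the trace code of `v`. -/
theorem sum_traceWeight_pow {N : ℕ} (v : Fin N → F)
    (C' : Submodule (ZMod 3) (Fin N → ZMod 3))
    (hC : ∀ u, u ∈ C' ↔ ∑ i, algebraMap (ZMod 3) F (u i) * v i = 0) (h : ℕ) :
    ∑ a : F, (traceWeight v a : ℂ) ^ h =
      (Fintype.card F : ℂ) * (2 * (2 / 3) ^ h * weightSum N h (weightDist C')) := by
  simp only [natCast_pow_eq_sum_stirlingTwo _ h]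
  rw [Finset.sum_comm]
  simp only [← Finset.mul_sum, sum_choose_traceWeight v C' hC]
  simp only [mul_left_comm _ (Fintype.card F : ℂ), ← Finset.mul_sum]
  congr 1
  simp only [Finset.mul_sum]
  rw [Finset.sum_comm, weightSum, Finset.mul_sum]
  symm
  refine (Finset.sum_subset (s₂ := range (N + 1)) (by intro x; simp only [Finset.mem_range]; omega)
    fun j hj hj' => ?_).trans (Finset.sum_congr rfl fun j hj => ?_)
  · rw [Finset.Icc_eq_empty (by simp only [Finset.mem_range] at *; omega)]
    simp
  · simp only [mul_ite, mul_zero]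
    rw [← Finset.sum_filter]
    have : (range (h + 1)).filter (fun t => j ≤ t) = Icc j h := by
      ext t
      simp only [Finset.mem_filter, Finset.mem_range, Finset.mem_Icc]
      omega
    rw [this, Finset.mul_sum, Finset.mul_sum]
    refine Finset.sum_congr rfl fun t ht => ?_
    have hth := (Finset.mem_Icc.1 ht).2
    have h3 : (3 : ℂ) ^ h = 3 ^ (h - t) * 3 ^ t := by rw [← pow_add, Nat.sub_add_cancel hth]
    -- The normalisation 2(2/3)^h converts the factor 3^{h-t} 2^{t-h-j-1} of `weightSum` into the
    -- 2^{t-j}/3^t of the binomial moments.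
    have h2 : (2 : ℂ) ^ ((t : ℤ) - h - j - 1) = 2 ^ ((t : ℤ) - j) / 2 ^ h / 2 := by
      rw [show (t : ℤ) - h - j - 1 = (t - j) - (h : ℕ) - (1 : ℕ) by push_cast; ring,
        zpow_sub₀ (by norm_num), zpow_sub₀ (by norm_num), zpow_natCast, zpow_natCast, pow_one]
    rw [div_pow, h3, h2]
    field_simp

end Coding

/-! ### Counting ternary words orthogonal to a given vector. -/

section Combinatorics

/-- A ternary word is a set A of positions of 1 together with a set of positions of -1 inside the
complement of A. -/
theorem card_ternary_words (κ : Type*) [Fintype κ] (a b : ℕ) :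
    Nat.card {u : κ → ZMod 3 // Nat.card {i // u i = 1} = a ∧ Nat.card {i // u i = -1} = b} =
      trinomial (Fintype.card κ : ℤ) a b := by
  classical
  rw [Nat.card_eq_fintype_card, Fintype.card_subtype]
  have h1 : #{u : κ → ZMod 3 | Nat.card {i // u i = 1} = a ∧ Nat.card {i // u i = -1} = b} =
      #((powersetCard a (univ : Finset κ)).sigma fun A => powersetCard b Aᶜ) := by
    refine Finset.card_nbij' (fun u => ⟨univ.filter (u · = 1), univ.filter (u · = -1)⟩)
      (fun p x => if x ∈ p.1 then 1 else if x ∈ p.2 then -1 else 0) ?_ ?_ ?_ ?_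
    · intro u hu
      simp only [Nat.card_eq_fintype_card, Fintype.card_subtype, Finset.coe_filter,
        Finset.mem_univ, true_and, Set.mem_ofPred_eq] at hu
      simp only [Finset.coe_sigma, Set.mem_sigma_iff, Finset.mem_coe, Finset.mem_powersetCard,
        Finset.subset_univ, true_and, hu, and_true]
      intro x hx
      simp only [Finset.mem_filter, Finset.mem_univ, true_and, Finset.mem_compl] at hx ⊢
      rw [hx]
      decide
    · rintro ⟨A, B⟩ hp
      simp only [Finset.coe_sigma, Set.mem_sigma_iff, Finset.mem_coe, Finset.mem_powersetCard,
        Finset.subset_univ, true_and] at hp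
      obtain ⟨hA, hBA, hB⟩ := hp
      simp only [Nat.card_eq_fintype_card, Fintype.card_subtype, Finset.coe_filter,
        Finset.mem_univ, true_and, Set.mem_ofPred_eq]
      constructor
      · rw [← hA]
        congr 1
        ext x
        by_cases h1 : x ∈ A <;> by_cases h2 : x ∈ B <;> simp [h1, h2] <;> decide
      · rw [← hB]
        congr 1
        ext x
        by_cases h1 : x ∈ A
        · have h2 : x ∉ B := fun h => Finset.mem_compl.1 (hBA h) h1
          simp [h1, h2]
          decide
        · by_cases h2 : x ∈ B <;> simp [h1, h2]
    · intro u _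
      ext x
      have h3 : ∀ y : ZMod 3, (if y = 1 then (1 : ZMod 3) else if y = -1 then -1 else 0) = y := by
        decide
      simpa using h3 (u x)
    · rintro ⟨A, B⟩ hp
      simp only [Finset.coe_sigma, Set.mem_sigma_iff, Finset.mem_coe, Finset.mem_powersetCard,
        Finset.subset_univ, true_and] at hp
      obtain ⟨hA, hBA, hB⟩ := hp
      simp only [Sigma.mk.injEq, heq_eq_eq]
      constructor
      · ext x
        by_cases h1 : x ∈ A <;> by_cases h2 : x ∈ B <;> simp [h1, h2] <;> decide
      · ext x
        by_cases h1 : x ∈ A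
        · have h2 : x ∉ B := fun h => Finset.mem_compl.1 (hBA h) h1
          simp [h1, h2]
          decide
        · by_cases h2 : x ∈ B <;> simp [h1, h2]
  rw [h1, Finset.card_sigma, Finset.sum_congr rfl (g := fun _ => (Fintype.card κ - a).choose b),
    Finset.sum_const, Finset.card_powersetCard, Finset.card_univ, smul_eq_mul, trinomial]
  · simp only [Int.toNat_natCast]
    split_ifs with h
    · have h' : a + b ≤ Fintype.card κ := by exact_mod_cast h
      symm
      apply Nat.div_eq_of_eq_mul_left (by positivity)
      rw [← Nat.choose_mul_factorial_mul_factorial (show a ≤ Fintype.card κ by omega),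
        ← Nat.choose_mul_factorial_mul_factorial (show b ≤ Fintype.card κ - a by omega)]
      ring
    · have h' : ¬ a + b ≤ Fintype.card κ := by exact_mod_cast h
      by_cases ha : a ≤ Fintype.card κ
      · rw [Nat.choose_eq_zero_of_lt (show Fintype.card κ - a < b by omega), mul_zero]
      · rw [Nat.choose_eq_zero_of_lt (by omega), zero_mul]
  · intro A hA
    rw [Finset.card_powersetCard, Finset.card_compl, (Finset.mem_powersetCard.1 hA).2]

/-- A word is a family of words on the fibres of w, and the conditions on different fibres are
independent. -/
theorem card_words_of_profile {ι κ : Type*} [Fintype ι] [Fintype κ] (w : ι → κ) (p : κ → ℕ × ℕ) :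
    Nat.card {u : ι → ZMod 3 // ∀ β, Nat.card {i // w i = β ∧ u i = 1} = (p β).1 ∧
        Nat.card {i // w i = β ∧ u i = -1} = (p β).2} =
      ∏ β, trinomial (Nat.card {i // w i = β} : ℤ) (p β).1 (p β).2 := by
  classical
  let e : (ι → ZMod 3) ≃ ∀ β, {i // w i = β} → ZMod 3 :=
    ((Equiv.sigmaFiberEquiv w).arrowCongr (Equiv.refl (ZMod 3))).symm.trans
      (Equiv.piCurry fun _ _ => ZMod 3)
  have he : ∀ u β (i : {i // w i = β}), e u β i = u i := fun _ _ _ => rfl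
  have key : ∀ (u : ι → ZMod 3) β (s : ZMod 3), Nat.card {i : {i // w i = β} // e u β i = s} =
      Nat.card {i // w i = β ∧ u i = s} := by
    intro u β s
    simp only [he]
    exact Nat.card_congr (Equiv.subtypeSubtypeEquivSubtypeInter (fun i => w i = β) (fun i => u i = s))
  rw [Nat.card_congr ((e.subtypeEquiv (q := fun g => ∀ β, Nat.card {i // g β i = 1} = (p β).1 ∧
    Nat.card {i // g β i = -1} = (p β).2) fun u => by simp only [key]).trans
    (Equiv.subtypePiEquivPi (p := fun β (g : {i // w i = β} → ZMod 3) =>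
      Nat.card {i // g i = 1} = (p β).1 ∧ Nat.card {i // g i = -1} = (p β).2))), Nat.card_pi]
  refine Finset.prod_congr rfl fun β _ => ?_
  rw [card_ternary_words, Nat.card_eq_fintype_card]

/-- The number of words of weight `j` orthogonal to a vector depends only on the numbers of
occurrences of its entries. -/
theorem card_orthogonal_words {F ι : Type*} [Field F] [Algebra (ZMod 3) F] [Fintype ι] (v : ι → F)
    (T : Finset F) (n : F → ℤ) (hT : ∀ i, v i ∈ T)
    (hn : ∀ β ∈ T, n β = Nat.card {i // v i = β}) (j : ℕ) :
    Nat.card {u : ι → ZMod 3 // ∑ i, algebraMap (ZMod 3) F (u i) * v i = 0 ∧ hammingNorm u = j} =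
      trinomialSum T n j := by
  classical
  let w : ι → T := fun i => ⟨v i, hT i⟩
  -- The profile of u: c 1 u and c (-1) u are the families ν and μ. Both the weight of u and its
  -- pairing with v depend only on them.
  let c : ZMod 3 → (ι → ZMod 3) → T → ℕ := fun s u β => Nat.card {i // w i = β ∧ u i = s}
  have hc : ∀ s u β, c s u β = ∑ i, if w i = β then if u i = s then 1 else 0 else 0 := by
    intro s u β
    simp only [c, Nat.card_eq_fintype_card, Fintype.card_subtype, Finset.card_filter, ite_and]
  have hnorm : ∀ u, hammingNorm u = ∑ β, c 1 u β + ∑ β, c (-1) u β := by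
    intro u
    have h3 : ∀ y : ZMod 3, (if y ≠ 0 then 1 else 0) =
      (if y = 1 then 1 else 0) + (if y = -1 then 1 else 0) := by decide
    simp only [hc]
    rw [Finset.sum_comm, Finset.sum_comm (f := fun β i => if w i = β then if u i = -1 then 1 else 0
      else 0)]
    simp only [Finset.sum_ite_eq, Finset.mem_univ, if_true]
    rw [hammingNorm, Finset.card_filter, ← Finset.sum_add_distrib]
    exact Finset.sum_congr rfl fun i _ => h3 (u i)
  have hcF : ∀ s u, ∑ β, (c s u β : F) * (β : F) = ∑ i, if u i = s then v i else 0 := by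
    intro s u
    simp only [hc, Nat.cast_sum, Finset.sum_mul]
    rw [Finset.sum_comm]
    refine Finset.sum_congr rfl fun i _ => ?_
    rw [Finset.sum_eq_single (w i)]
    · by_cases h : u i = s <;> simp [h, w]
    · intro β _ hβ
      simp [hβ.symm]
    · simp
  have hsum : ∀ u : ι → ZMod 3, ∑ i, algebraMap (ZMod 3) F (u i) * v i =
      ∑ β, (c 1 u β : F) * (β : F) - ∑ β, (c (-1) u β : F) * (β : F) := by
    intro u
    rw [hcF, hcF, ← Finset.sum_sub_distrib]
    refine Finset.sum_congr rfl fun i _ => ?_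
    have h3 : ∀ y : ZMod 3, y = 0 ∨ y = 1 ∨ y = -1 := by decide
    have e1 : (0 : ZMod 3) ≠ 1 := by decide
    have e2 : (0 : ZMod 3) ≠ -1 := by decide
    have e3 : (1 : ZMod 3) ≠ -1 := by decide
    rcases h3 (u i) with h | h | h <;> simp [h, e1, e2, e3, e3.symm]
  rw [Nat.card_eq_fintype_card, Fintype.card_subtype, trinomialSum,
    Finset.card_eq_sum_card_fiberwise (f := fun u => (c 1 u, c (-1) u)) (t :=
      ((Fintype.piFinset fun _ : T => Finset.range (j + 1)) ×ˢ
        (Fintype.piFinset fun _ : T => Finset.range (j + 1))).filter fun p =>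
      (∑ β : T, p.1 β + ∑ β : T, p.2 β = j ∧
        ∑ β : T, (p.1 β : F) * (β : F) = ∑ β : T, (p.2 β : F) * (β : F)))]
  · refine Finset.sum_congr rfl fun p hp => ?_
    have hp' := (Finset.mem_filter.1 hp).2
    have h1 := card_words_of_profile w fun β => (p.1 β, p.2 β)
    rw [Nat.card_eq_fintype_card, Fintype.card_subtype] at h1
    rw [Finset.filter_filter]
    refine Eq.trans (congr_arg Finset.card ?_) (h1.trans ?_)
    · refine Finset.filter_congr fun u _ => ?_
      have hiff : (c 1 u, c (-1) u) = p ↔ ∀ β, c 1 u β = p.1 β ∧ c (-1) u β = p.2 β := by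
        rw [Prod.ext_iff, funext_iff, funext_iff, forall_and]
      rw [hiff]
      refine ⟨fun h => h.2, fun h => ⟨?_, h⟩⟩
      rw [hsum, hnorm]
      have ha : c 1 u = p.1 := funext fun β => (h β).1
      have hb : c (-1) u = p.2 := funext fun β => (h β).2
      rw [ha, hb, sub_eq_zero]
      exact ⟨hp'.2, hp'.1⟩
    · refine Finset.prod_congr rfl fun β _ => ?_
      rw [hn β β.2]
      have : Nat.card {i // w i = β} = Nat.card {i // v i = β} :=
        Nat.card_congr (Equiv.subtypeEquivRight fun i => Subtype.ext_iff)
      rw [this]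
  · intro u hu
    simp only [Finset.coe_filter, Finset.mem_univ, true_and, Set.mem_ofPred_eq] at hu
    obtain ⟨hu1, hu2⟩ := hu
    rw [hsum, sub_eq_zero] at hu1
    rw [hnorm] at hu2
    simp only [Finset.coe_filter, Set.mem_ofPred_eq, Finset.mem_product, Fintype.mem_piFinset,
      Finset.mem_range]
    refine ⟨⟨fun β => ?_, fun β => ?_⟩, hu2, hu1⟩
    · have := Finset.single_le_sum (f := c 1 u) (fun _ _ => Nat.zero_le _) (Finset.mem_univ β)
      omega
    · have := Finset.single_le_sum (f := c (-1) u) (fun _ _ => Nat.zero_le _) (Finset.mem_univ β)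
      omega

end Combinatorics

/-! ### From group elements to matrices of given determinant and trace. -/

section Isometries

variable {F : Type*} [Field F]

/-- The number of isometries of the bilinear form `J` of determinant `d` and trace `β`. -/
noncomputable def isometryCount {m : Type*} [Fintype m] [DecidableEq m] (J : Matrix m m F)
    (d β : F) : ℕ :=
  Nat.card {M : Matrix m m F // Mᵀ * J * M = J ∧ M.det = d ∧ M.trace = β}

theorem isometryCount_reindex {m m' : Type*} [Fintype m] [DecidableEq m] [Fintype m']
    [DecidableEq m'] (e : m ≃ m') (J : Matrix m m F) (d β : F) :
    isometryCount (Matrix.reindex e e J) d β = isometryCount J d β := by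
  refine (Nat.card_congr ((Matrix.reindex e e).subtypeEquiv fun M => ?_)).symm
  have h1 : (Matrix.reindex e e M)ᵀ * Matrix.reindex e e J * Matrix.reindex e e M =
      Matrix.reindex e e (Mᵀ * J * M) := by
    simp only [Matrix.reindex_apply, Matrix.transpose_submatrix, Matrix.submatrix_mul_equiv]
  have h2 : (Matrix.reindex e e M).trace = M.trace := by
    simp only [Matrix.trace, Matrix.diag_apply, Matrix.reindex_apply, Matrix.submatrix_apply]
    exact Equiv.sum_comp e.symm fun i => M i i
  rw [h1, h2, Matrix.det_reindex_self, (Matrix.reindex e e).apply_eq_iff_eq]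

theorem mem_OMinus {n : ℕ} {ε : F} {w : GL (MinusIndex n) F} : w ∈ OMinus n ε ↔
    (w : Matrix (MinusIndex n) (MinusIndex n) F)ᵀ * minusForm n ε *
      (w : Matrix (MinusIndex n) (MinusIndex n) F) = minusForm n ε := Iff.rfl

theorem mem_SOMinus {n : ℕ} {ε : F} {w : GL (MinusIndex n) F} : w ∈ SOMinus n ε ↔
    (w : Matrix (MinusIndex n) (MinusIndex n) F)ᵀ * minusForm n ε *
      (w : Matrix (MinusIndex n) (MinusIndex n) F) = minusForm n ε ∧
      (w : Matrix (MinusIndex n) (MinusIndex n) F).det = 1 := by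
  rw [SOMinus, Subgroup.mem_inf, mem_OMinus, MonoidHom.mem_ker, Units.ext_iff]
  rfl

theorem card_SOMinus_trace (n : ℕ) (ε β : F) :
    Nat.card {w : SOMinus n ε // Matrix.trace ((w : GL (MinusIndex n) F) :
      Matrix (MinusIndex n) (MinusIndex n) F) = β} = isometryCount (minusForm n ε) 1 β := by
  have hdet : ∀ M : {M : Matrix (MinusIndex n) (MinusIndex n) F //
      Mᵀ * minusForm n ε * M = minusForm n ε ∧ M.det = 1 ∧ M.trace = β}, M.1.det ≠ 0 := by
    intro M
    rw [M.2.2.1]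
    exact one_ne_zero
  exact Nat.card_congr
    { toFun := fun w => ⟨_, (mem_SOMinus.1 w.1.2).1, (mem_SOMinus.1 w.1.2).2, w.2⟩
      invFun := fun M => ⟨⟨Matrix.GeneralLinearGroup.mkOfDetNeZero M.1 (hdet M),
        mem_SOMinus.2 ⟨M.2.1, M.2.2.1⟩⟩, M.2.2.2⟩
      left_inv := fun w => by
        apply Subtype.ext
        apply Subtype.ext
        ext
        rfl
      right_inv := fun M => rfl }

theorem card_OMinus_trace [Fintype F] (n : ℕ) (ε β : F) (h2 : (2 : F) ≠ 0)
    (hJ : (minusForm n ε).det ≠ 0) :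
    Nat.card {w : OMinus n ε // Matrix.trace ((w : GL (MinusIndex n) F) :
      Matrix (MinusIndex n) (MinusIndex n) F) = β} =
      isometryCount (minusForm n ε) 1 β + isometryCount (minusForm n ε) (-1) β := by
  classical
  have h11 : (1 : F) ≠ -1 := by
    intro h
    apply h2
    linear_combination h
  have hdet : ∀ M : Matrix (MinusIndex n) (MinusIndex n) F,
      Mᵀ * minusForm n ε * M = minusForm n ε → M.det = 1 ∨ M.det = -1 := by
    intro M hM
    have h := congr_arg Matrix.det hM
    rw [Matrix.det_mul, Matrix.det_mul, Matrix.det_transpose] at h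
    refine (sq_eq_sq_iff_eq_or_eq_neg.1 ?_)
    apply mul_left_cancel₀ hJ
    linear_combination h
  have hne : ∀ M : {M : Matrix (MinusIndex n) (MinusIndex n) F //
      Mᵀ * minusForm n ε * M = minusForm n ε ∧ M.trace = β}, M.1.det ≠ 0 := by
    intro M
    rcases hdet _ M.2.1 with h | h <;> rw [h]
    · exact one_ne_zero
    · exact neg_ne_zero.2 one_ne_zero
  have e : {w : OMinus n ε // Matrix.trace ((w : GL (MinusIndex n) F) :
      Matrix (MinusIndex n) (MinusIndex n) F) = β} ≃ {M : Matrix (MinusIndex n) (MinusIndex n) F //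
      Mᵀ * minusForm n ε * M = minusForm n ε ∧ M.trace = β} :=
    { toFun := fun w => ⟨_, w.1.2, w.2⟩
      invFun := fun M => ⟨⟨Matrix.GeneralLinearGroup.mkOfDetNeZero M.1 (hne M), M.2.1⟩, M.2.2⟩
      left_inv := fun w => by
        apply Subtype.ext
        apply Subtype.ext
        ext
        rfl
      right_inv := fun M => rfl }
  rw [Nat.card_congr e, isometryCount, isometryCount]
  simp only [Nat.card_eq_fintype_card, Fintype.card_subtype]
  rw [← Finset.card_union_of_disjoint]
  · congr 1
    ext M
    simp only [Finset.mem_union, Finset.mem_filter, Finset.mem_univ, true_and]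
    constructor
    · rintro ⟨h1, h3⟩
      rcases hdet M h1 with h | h
      · exact Or.inl ⟨h1, h, h3⟩
      · exact Or.inr ⟨h1, h, h3⟩
    · rintro (h | h)
      · exact ⟨h.1, h.2.2⟩
      · exact ⟨h.1, h.2.2⟩
  · rw [Finset.disjoint_filter]
    rintro M - ⟨_, h, _⟩ ⟨_, h', _⟩
    exact h11 (h.symm.trans h')

end Isometries

/-! ### Dimension two: the norm-one conic in characteristic three. -/

section CharThree

variable {F : Type*} [Field F]

/-- The number of nonzero `α` with `α + α⁻¹ = β`. -/
noncomputable def deltaOne (β : F) : ℕ := Nat.card {α : Fˣ // (α : F) + (α : F)⁻¹ = β}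

/-- The points of the norm-one conic `a² - ε b² = 1`. -/
abbrev NormOne (ε : F) : Type _ := {p : F × F // p.1 ^ 2 - ε * p.2 ^ 2 = 1}

theorem card_subtype_prod {α β : Type*} [Fintype α] [Finite β] (P : α × β → Prop) :
    Nat.card {x // P x} = ∑ a, Nat.card {b // P (a, b)} := by
  rw [Nat.card_congr (Equiv.subtypeProdEquivSigmaSubtype fun a b => P (a, b)), Nat.card_sigma]

variable [Fintype F]

omit [Fintype F] in
theorem ringChar_ne_two (h3 : (3 : F) = 0) : ringChar F ≠ 2 := by
  intro h
  have h2 : ((2 : ℕ) : F) = 0 := by rw [← h]; exact ringChar.Nat.cast_ringChar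
  exact one_ne_zero (α := F) (by push_cast at h2; linear_combination h3 - h2)

theorem card_sqrt [DecidableEq F] (h3 : (3 : F) = 0) (c : F) :
    (Nat.card {x : F // x ^ 2 = c} : ℤ) = quadraticChar F c + 1 := by
  rw [← quadraticChar_card_sqrts (ringChar_ne_two h3) c, Nat.card_eq_fintype_card,
    Set.toFinset_card]
  rfl

/-- Completing the square in α² - βα + 1 = 0: as -1 = 2, the substitution x = α + β gives x² = β² -
1. The excluded value α = 0 would mean x = β, which is no solution. -/
theorem deltaOne_eq_quadraticChar_add_one [DecidableEq F] (h3 : (3 : F) = 0) (β : F) :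
    (deltaOne β : ℤ) = quadraticChar F (β ^ 2 - 1) + 1 := by
  have hx : ∀ x : F, x ^ 2 = β ^ 2 - 1 → x - β ≠ 0 := by
    intro x hx h
    have : x = β := sub_eq_zero.1 h
    rw [this] at hx
    exact one_ne_zero (α := F) (by linear_combination hx)
  rw [← card_sqrt h3, deltaOne]
  congr 1
  refine Nat.card_congr
    { toFun := fun α => ⟨(α.1 : F) + β, ?_⟩
      invFun := fun x => ⟨Units.mk0 (x.1 - β) (hx x.1 x.2), ?_⟩
      left_inv := fun α => by
        apply Subtype.ext
        ext
        simp
      right_inv := fun x => by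
        apply Subtype.ext
        simp }
  · have h := α.2
    have h0 : (α.1 : F) ≠ 0 := α.1.ne_zero
    field_simp at h
    linear_combination h + α.1 * β * h3
  · have h0 := hx x.1 x.2
    rw [Units.val_mk0]
    field_simp
    linear_combination x.2 + (-x.1 * β + β ^ 2) * h3

/-- Twisting by the nonsquare ε flips the sign of the quadratic character of β² - 1, so the two
counts are 1 - χ and 1 + χ. This is what links the nonsplit torus to Kloosterman sums. -/
theorem card_sqrt_add_deltaOne (h3 : (3 : F) = 0) {ε : F} (hε : ¬ IsSquare ε) (β : F) :
    Nat.card {b : F // ε * b ^ 2 = β ^ 2 - 1} + deltaOne β = 2 := by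
  classical
  have hε0 : ε ≠ 0 := by rintro rfl; exact hε IsSquare.zero
  have h1 : Nat.card {b : F // ε * b ^ 2 = β ^ 2 - 1} =
      Nat.card {x : F // x ^ 2 = (β ^ 2 - 1) * ε⁻¹} := by
    refine Nat.card_congr (Equiv.subtypeEquivRight fun b => ?_)
    rw [eq_mul_inv_iff_mul_eq₀ hε0, mul_comm]
  have hz : ((Nat.card {b : F // ε * b ^ 2 = β ^ 2 - 1} + deltaOne β : ℕ) : ℤ) = 2 := by
    rw [h1]
    push_cast
    rw [card_sqrt h3, deltaOne_eq_quadraticChar_add_one h3, map_mul,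
      quadraticChar_neg_one_iff_not_isSquare.2 (show ¬ IsSquare ε⁻¹ by rwa [isSquare_inv])]
    ring
  exact_mod_cast hz

theorem deltaOne_eq_ite (h3 : (3 : F) = 0) [DecidableEq F] (β : F)
    [Decidable (IsSquare (β ^ 2 - 1))] :
    deltaOne β = if β = 1 ∨ β = -1 then 1 else if IsSquare (β ^ 2 - 1) then 2 else 0 := by
  have h := deltaOne_eq_quadraticChar_add_one h3 β
  have h1 : β = 1 ∨ β = -1 ↔ β ^ 2 - 1 = 0 := by
    rw [sub_eq_zero, ← sq_eq_sq_iff_eq_or_eq_neg, one_pow]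
  split_ifs with hβ hs
  · rw [h1.1 hβ, MulChar.map_zero] at h
    exact_mod_cast h
  · rw [(quadraticChar_one_iff_isSquare (mt h1.2 hβ)).2 hs] at h
    exact_mod_cast h
  · rw [quadraticChar_neg_one_iff_not_isSquare.2 hs] at h
    omega

theorem sum_deltaOne : ∑ β : F, deltaOne β + 1 = Fintype.card F := by
  classical
  have : ∑ β : F, deltaOne β = Nat.card Fˣ := by
    rw [← Nat.card_congr (Equiv.sigmaFiberEquiv fun α : Fˣ => (α : F) + (α : F)⁻¹), Nat.card_sigma]
    rfl
  rw [this, Nat.card_eq_fintype_card, Fintype.card_units]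
  exact Nat.sub_add_cancel Fintype.card_pos

omit [Fintype F] in
theorem card_normOne_fst (ε γ : F) : Nat.card {p : NormOne ε // p.1.1 = γ} =
    Nat.card {b : F // ε * b ^ 2 = γ ^ 2 - 1} := by
  refine Nat.card_congr
    { toFun := fun p => ⟨p.1.1.2, ?_⟩
      invFun := fun b => ⟨⟨(γ, b.1), ?_⟩, rfl⟩
      left_inv := ?_
      right_inv := fun b => rfl }
  · have := p.1.2
    rw [p.2] at this
    linear_combination -this
  · have := b.2
    simp only
    linear_combination -this
  · rintro ⟨⟨⟨a, b⟩, h⟩, rfl⟩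
    rfl

theorem card_normOne (h3 : (3 : F) = 0) {ε : F} (hε : ¬ IsSquare ε) :
    Nat.card (NormOne ε) = Fintype.card F + 1 := by
  have h1 : Nat.card (NormOne ε) = ∑ γ : F, Nat.card {b : F // ε * b ^ 2 = γ ^ 2 - 1} := by
    rw [← Nat.card_congr (Equiv.sigmaFiberEquiv fun p : NormOne ε => p.1.1), Nat.card_sigma]
    exact Finset.sum_congr rfl fun γ _ => card_normOne_fst ε γ
  have h2 : ∑ γ : F, (Nat.card {b : F // ε * b ^ 2 = γ ^ 2 - 1} + deltaOne γ) =
      ∑ _γ : F, 2 := Finset.sum_congr rfl fun γ _ => card_sqrt_add_deltaOne h3 hε γ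
  rw [Finset.sum_add_distrib, Finset.sum_const, Finset.card_univ, smul_eq_mul] at h2
  have := sum_deltaOne (F := F)
  omega

/-- The isometries of determinant `δ = ±1` of the form `x² - ε y²`. -/
def planeIsometryEquiv {ε δ : F} (hδ : δ ^ 2 = 1) : NormOne ε ≃
    {M : Matrix (Fin 2) (Fin 2) F // Mᵀ * !![1, 0; 0, -ε] * M = !![1, 0; 0, -ε] ∧ M.det = δ} where
  toFun p := ⟨!![p.1.1, ε * p.1.2 * δ; p.1.2, p.1.1 * δ], by
    have h := p.2
    constructor
    · ext i j
      fin_cases i <;> fin_cases j <;> simp [Matrix.mul_apply, Fin.sum_univ_two]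
      · linear_combination h
      · ring
      · ring
      · linear_combination -ε * δ ^ 2 * h - ε * hδ
    · rw [Matrix.det_fin_two_of]
      linear_combination δ * h⟩
  invFun M := ⟨(M.1 0 0, M.1 1 0), by
    have h := congr_fun (congr_fun M.2.1 0) 0
    simp [Matrix.mul_apply, Fin.sum_univ_two] at h
    linear_combination h⟩
  left_inv p := rfl
  right_inv M := by
    obtain ⟨M, hM, hd⟩ := M
    have h00 := congr_fun (congr_fun hM 0) 0
    have h01 := congr_fun (congr_fun hM 0) 1
    simp [Matrix.mul_apply, Fin.sum_univ_two] at h00 h01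
    rw [Matrix.det_fin_two] at hd
    apply Subtype.ext
    ext i j
    fin_cases i <;> fin_cases j <;> simp
    -- Orthogonality of the columns and the value of the determinant are linear equations in the
    -- second column, with coefficient determinant M₀₀² - εM₁₀² = 1; Cramer's rule solves them.
    · linear_combination M 0 1 * h00 - M 0 0 * h01 - ε * M 1 0 * hd
    · linear_combination M 1 1 * h00 - M 1 0 * h01 - M 0 0 * hd

omit [Fintype F] in
theorem isometryCount_plane {ε δ : F} (hδ : δ ^ 2 = 1) (β : F) :
    isometryCount !![1, 0; 0, -ε] δ β =
      Nat.card {p : NormOne ε // p.1.1 + p.1.1 * δ = β} := by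
  refine (Nat.card_congr (((planeIsometryEquiv hδ).subtypeEquiv (q := fun M =>
    M.1.trace = β) fun p => ?_).trans ((Equiv.subtypeSubtypeEquivSubtypeInter
      (fun M : Matrix (Fin 2) (Fin 2) F => Mᵀ * !![1, 0; 0, -ε] * M = !![1, 0; 0, -ε] ∧ M.det = δ)
      (fun M => M.trace = β)).trans
      (Equiv.subtypeEquivRight fun M => and_assoc)))).symm
  rw [show (planeIsometryEquiv hδ p).1.trace = p.1.1 + p.1.1 * δ from
    Matrix.trace_fin_two_of _ _ _ _]

end CharThree

/-! ### Dimension four: the parabolic subgroup and the big cell. -/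

section FourDim

variable {F : Type*} [Field F]

/-- The form `2 x₀ x₁ + x₂² - ε x₃²`. -/
abbrev quaternaryForm (ε : F) : Matrix (Fin 4) (Fin 4) F :=
  !![0, 1, 0, 0; 1, 0, 0, 0; 0, 0, 1, 0; 0, 0, 0, -ε]

theorem isometry_quaternaryForm_iff {ε : F} {M : Matrix (Fin 4) (Fin 4) F} :
    Mᵀ * quaternaryForm ε * M = quaternaryForm ε ↔ ∀ i j,
      M 0 i * M 1 j + M 1 i * M 0 j + M 2 i * M 2 j - ε * M 3 i * M 3 j = quaternaryForm ε i j := by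
  rw [← Matrix.ext_iff]
  refine forall_congr' fun i => forall_congr' fun j => ?_
  have : (Mᵀ * quaternaryForm ε * M) i j =
      M 0 i * M 1 j + M 1 i * M 0 j + M 2 i * M 2 j - ε * M 3 i * M 3 j := by
    simp [Matrix.mul_apply, Fin.sum_univ_four]
    ring
  rw [this]

theorem det_fin_four (M : Matrix (Fin 4) (Fin 4) F) : M.det =
    M 0 0 * (M 1 1 * (M 2 2 * M 3 3 - M 2 3 * M 3 2) - M 1 2 * (M 2 1 * M 3 3 - M 2 3 * M 3 1)
      + M 1 3 * (M 2 1 * M 3 2 - M 2 2 * M 3 1))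
    - M 0 1 * (M 1 0 * (M 2 2 * M 3 3 - M 2 3 * M 3 2) - M 1 2 * (M 2 0 * M 3 3 - M 2 3 * M 3 0)
      + M 1 3 * (M 2 0 * M 3 2 - M 2 2 * M 3 0))
    + M 0 2 * (M 1 0 * (M 2 1 * M 3 3 - M 2 3 * M 3 1) - M 1 1 * (M 2 0 * M 3 3 - M 2 3 * M 3 0)
      + M 1 3 * (M 2 0 * M 3 1 - M 2 1 * M 3 0))
    - M 0 3 * (M 1 0 * (M 2 1 * M 3 2 - M 2 2 * M 3 1) - M 1 1 * (M 2 0 * M 3 2 - M 2 2 * M 3 0)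
      + M 1 2 * (M 2 0 * M 3 1 - M 2 1 * M 3 0)) := by
  rw [Matrix.det_succ_row_zero]
  simp only [Fin.sum_univ_four, Matrix.det_fin_three, Matrix.submatrix_apply]
  simp [Fin.succAbove, Fin.lt_def]
  ring

/-- The isometries of determinant `δ` fixing the isotropic line `⟨e₀⟩`, in coordinates. -/
def parabolicMatrix (ε δ y z a b m n : F) : Matrix (Fin 4) (Fin 4) F :=
  !![y, y * (m ^ 2 - ε * n ^ 2), -y * (m * a - ε * n * b), -y * (m * ε * b - ε * n * a) * δ;
     0, z, 0, 0;
     0, m, a, ε * b * δ;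
     0, n, b, a * δ]

/-- Anisotropy of x² - εy²: a nontrivial zero would exhibit ε as a square. -/
theorem norm_eq_zero_iff {ε : F} (hε : ¬ IsSquare ε) {x y : F} :
    x ^ 2 - ε * y ^ 2 = 0 ↔ x = 0 ∧ y = 0 := by
  constructor
  · intro h
    have hy : y = 0 := by
      by_contra hy
      refine hε ⟨x / y, ?_⟩
      field_simp
      linear_combination -h
    subst hy
    exact ⟨by simpa using h, rfl⟩
  · rintro ⟨rfl, rfl⟩
    ring

/-- The entry y(m² - εn²) is the usual -½ y(m² - εn²), because -½ = 1 in characteristic three. -/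
theorem parabolicMatrix_isometry (h3 : (3 : F) = 0) {ε δ y z a b : F} (m n : F) (hδ : δ ^ 2 = 1)
    (hyz : y * z = 1) (hab : a ^ 2 - ε * b ^ 2 = 1) :
    (parabolicMatrix ε δ y z a b m n)ᵀ * quaternaryForm ε * parabolicMatrix ε δ y z a b m n =
      quaternaryForm ε := by
  rw [isometry_quaternaryForm_iff]
  intro i j
  fin_cases i <;> fin_cases j <;> simp [parabolicMatrix]
  · linear_combination hyz
  · linear_combination hyz
  · linear_combination 2 * (m ^ 2 - ε * n ^ 2) * hyz + (m ^ 2 - ε * n ^ 2) * h3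
  · linear_combination -(m * a - ε * n * b) * hyz
  · linear_combination -(m * ε * b - ε * n * a) * δ * hyz
  · linear_combination -(m * a - ε * n * b) * hyz
  · linear_combination hab
  · ring
  · linear_combination -(m * ε * b - ε * n * a) * δ * hyz
  · ring
  · linear_combination -ε * δ ^ 2 * hab - ε * hδ

theorem det_parabolicMatrix {ε δ y z a b : F} (m n : F)
    (hyz : y * z = 1) (hab : a ^ 2 - ε * b ^ 2 = 1) :
    (parabolicMatrix ε δ y z a b m n).det = δ := by
  rw [det_fin_four]
  simp [parabolicMatrix]
  linear_combination (a ^ 2 - ε * b ^ 2) * δ * hyz + δ * hab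

/-- The isometries of determinant `δ` of the quaternary form preserving the line `⟨e₀⟩`. -/
abbrev ParabolicIsometry (ε δ : F) : Type _ :=
  {M : Matrix (Fin 4) (Fin 4) F // Mᵀ * quaternaryForm ε * M = quaternaryForm ε ∧ M.det = δ ∧
    M 1 0 = 0}

/-- Isotropy of the first column and M₁₀ = 0 put its last two entries in the kernel of the
anisotropic form, so e₀ goes to a multiple of itself. Orthogonality to that column clears the rest
of row 1; the lower right block is then a plane isometry of determinant δ, and the remaining entries
of row 0 are forced. -/
theorem eq_parabolicMatrix (h3 : (3 : F) = 0) {ε δ : F} (hε : ¬ IsSquare ε)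
    {M : Matrix (Fin 4) (Fin 4) F} (hM : Mᵀ * quaternaryForm ε * M = quaternaryForm ε)
    (hd : M.det = δ) (h10 : M 1 0 = 0) :
    M 0 0 * M 1 1 = 1 ∧ M 2 2 ^ 2 - ε * M 3 2 ^ 2 = 1 ∧
      M = parabolicMatrix ε δ (M 0 0) (M 1 1) (M 2 2) (M 3 2) (M 2 1) (M 3 1) := by
  rw [isometry_quaternaryForm_iff] at hM
  have h00 := hM 0 0
  have h01 := hM 0 1
  have h02 := hM 0 2
  have h03 := hM 0 3
  have h11 := hM 1 1
  have h12 := hM 1 2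
  have h13 := hM 1 3
  have h22 := hM 2 2
  have h23 := hM 2 3
  simp at h00 h01 h02 h03 h11 h12 h13 h22 h23
  rw [h10] at h00 h01 h02 h03
  obtain ⟨h20, h30⟩ := (norm_eq_zero_iff hε (x := M 2 0) (y := M 3 0)).1
    (by linear_combination h00)
  rw [h20, h30] at h01 h02 h03
  have hyz : M 0 0 * M 1 1 = 1 := by linear_combination h01
  have hy : M 0 0 ≠ 0 := left_ne_zero_of_mul_eq_one hyz
  have h12' : M 1 2 = 0 := (mul_eq_zero.1
    (show M 0 0 * M 1 2 = 0 by linear_combination h02)).resolve_left hy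
  have h13' : M 1 3 = 0 := (mul_eq_zero.1
    (show M 0 0 * M 1 3 = 0 by linear_combination h03)).resolve_left hy
  rw [h12'] at h12 h22 h23
  rw [h13'] at h13 h23
  have hab : M 2 2 ^ 2 - ε * M 3 2 ^ 2 = 1 := by linear_combination h22
  rw [det_fin_four, h10, h20, h30, h12', h13'] at hd
  have hd' : M 2 2 * M 3 3 - M 2 3 * M 3 2 = δ := by
    linear_combination hd - (M 2 2 * M 3 3 - M 2 3 * M 3 2) * hyz
  -- Cramer's rule for the last column of the plane block, whose coefficient determinant is 1 by
  -- `hab`.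
  have h23' : M 2 3 = ε * M 3 2 * δ := by
    linear_combination -M 2 3 * hab + M 2 2 * h23 + ε * M 3 2 * hd'
  have h33' : M 3 3 = M 2 2 * δ := by
    linear_combination -M 3 3 * hab + M 3 2 * h23 + M 2 2 * hd'
  refine ⟨hyz, hab, ?_⟩
  ext i j
  fin_cases i <;> fin_cases j <;> simp [parabolicMatrix]
  · linear_combination -M 0 0 * h11 + 2 * M 0 1 * hyz + M 0 1 * h3
  · linear_combination M 0 0 * h12 - M 0 2 * hyz
  · rw [h23', h33'] at h13
    linear_combination M 0 0 * h13 - M 0 3 * hyz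
  · exact h10
  · exact h12'
  · exact h13'
  · exact h20
  · exact h23'
  · exact h30
  · exact h33'

/-- Coordinates on the isometries preserving the line `⟨e₀⟩`. -/
def parabolicEquiv (h3 : (3 : F) = 0) {ε δ : F} (hε : ¬ IsSquare ε) (hδ : δ ^ 2 = 1) :
    (Fˣ × NormOne ε) × F × F ≃ ParabolicIsometry ε δ where
  toFun p := ⟨parabolicMatrix ε δ p.1.1 (p.1.1 : F)⁻¹ p.1.2.1.1 p.1.2.1.2 p.2.1 p.2.2,
    parabolicMatrix_isometry h3 _ _ hδ (mul_inv_cancel₀ p.1.1.ne_zero) p.1.2.2,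
    det_parabolicMatrix _ _ (mul_inv_cancel₀ p.1.1.ne_zero) p.1.2.2, rfl⟩
  invFun M :=
    have h := eq_parabolicMatrix h3 hε M.2.1 M.2.2.1 M.2.2.2
    ((⟨M.1 0 0, M.1 1 1, h.1, (mul_comm _ _).trans h.1⟩, ⟨(M.1 2 2, M.1 3 2), h.2.1⟩),
      M.1 2 1, M.1 3 1)
  left_inv p := by
    refine Prod.ext (Prod.ext ?_ rfl) rfl
    ext
    rfl
  right_inv M := by
    have h := eq_parabolicMatrix h3 hε M.2.1 M.2.2.1 M.2.2.2
    apply Subtype.ext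
    refine Eq.trans ?_ h.2.2.symm
    change parabolicMatrix ε δ (M.1 0 0) (M.1 0 0)⁻¹ (M.1 2 2) (M.1 3 2) (M.1 2 1) (M.1 3 1) = _
    rw [inv_eq_of_mul_eq_one_right h.1]

/-- The reflection exchanging `e₀` and `e₁`. -/
def swapMatrix : Matrix (Fin 4) (Fin 4) F :=
  !![0, 1, 0, 0; 1, 0, 0, 0; 0, 0, 1, 0; 0, 0, 0, 1]

theorem swapMatrix_mul_self : (swapMatrix : Matrix (Fin 4) (Fin 4) F) * swapMatrix = 1 := by
  ext i j
  fin_cases i <;> fin_cases j <;> simp [swapMatrix, Matrix.mul_apply, Fin.sum_univ_four]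

theorem swapMatrix_isometry (ε : F) :
    swapMatrixᵀ * quaternaryForm ε * swapMatrix = quaternaryForm ε := by
  rw [isometry_quaternaryForm_iff]
  intro i j
  fin_cases i <;> fin_cases j <;> simp [swapMatrix]

theorem det_swapMatrix : (swapMatrix : Matrix (Fin 4) (Fin 4) F).det = -1 := by
  rw [det_fin_four]
  simp [swapMatrix]

/-- The unipotent isometries fixing `e₀`. -/
def unipotentMatrix (ε k l : F) : Matrix (Fin 4) (Fin 4) F := parabolicMatrix ε 1 1 1 1 0 k l

theorem unipotentMatrix_isometry (h3 : (3 : F) = 0) (ε k l : F) :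
    (unipotentMatrix ε k l)ᵀ * quaternaryForm ε * unipotentMatrix ε k l = quaternaryForm ε :=
  parabolicMatrix_isometry h3 _ _ (by simp) (by simp) (by simp)

theorem det_unipotentMatrix (ε k l : F) : (unipotentMatrix ε k l).det = 1 :=
  det_parabolicMatrix _ _ (by simp) (by simp)

theorem unipotentMatrix_mul_neg (h3 : (3 : F) = 0) (ε k l : F) :
    unipotentMatrix ε k l * unipotentMatrix ε (-k) (-l) = 1 := by
  ext i j
  fin_cases i <;> fin_cases j <;>
    simp [unipotentMatrix, parabolicMatrix, Matrix.mul_apply, Fin.sum_univ_four]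
  linear_combination (k ^ 2 - ε * l ^ 2) * h3

theorem isometry_mul {m : Type*} [Fintype m] {J A B : Matrix m m F} (hA : Aᵀ * J * A = J)
    (hB : Bᵀ * J * B = J) : (A * B)ᵀ * J * (A * B) = J := by
  rw [Matrix.transpose_mul]
  calc Bᵀ * Aᵀ * J * (A * B) = Bᵀ * (Aᵀ * J * A) * B := by simp only [Matrix.mul_assoc]
    _ = J := by rw [hA, hB]

/-- The isometries of determinant `1` of the quaternary form moving the line `⟨e₀⟩` to a line
not orthogonal to it. -/
abbrev BigCellIsometry (ε : F) : Type _ :=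
  {M : Matrix (Fin 4) (Fin 4) F // Mᵀ * quaternaryForm ε * M = quaternaryForm ε ∧ M.det = 1 ∧
    ¬ M 1 0 = 0}

/-- The element `u σ M` of the big cell. -/
def bigCellMatrix (ε k l : F) (M : Matrix (Fin 4) (Fin 4) F) : Matrix (Fin 4) (Fin 4) F :=
  unipotentMatrix ε k l * (swapMatrix * M)

/-- The element `σ u⁻¹ M`, recovering a parabolic element from one of the big cell. -/
def bigCellFactor (ε k l : F) (M : Matrix (Fin 4) (Fin 4) F) : Matrix (Fin 4) (Fin 4) F :=
  swapMatrix * (unipotentMatrix ε (-k) (-l) * M)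

theorem bigCellFactor_bigCellMatrix (h3 : (3 : F) = 0) (ε k l : F)
    (M : Matrix (Fin 4) (Fin 4) F) : bigCellFactor ε k l (bigCellMatrix ε k l M) = M := by
  have := unipotentMatrix_mul_neg h3 ε (-k) (-l)
  rw [neg_neg, neg_neg] at this
  rw [bigCellFactor, bigCellMatrix, ← Matrix.mul_assoc (unipotentMatrix ε (-k) (-l)), this,
    Matrix.one_mul, ← Matrix.mul_assoc, swapMatrix_mul_self, Matrix.one_mul]

theorem bigCellMatrix_bigCellFactor (h3 : (3 : F) = 0) (ε k l : F)
    (M : Matrix (Fin 4) (Fin 4) F) : bigCellMatrix ε k l (bigCellFactor ε k l M) = M := by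
  rw [bigCellFactor, bigCellMatrix, ← Matrix.mul_assoc swapMatrix, swapMatrix_mul_self,
    Matrix.one_mul, ← Matrix.mul_assoc, unipotentMatrix_mul_neg h3, Matrix.one_mul]

theorem bigCellMatrix_apply (ε k l : F) (M : Matrix (Fin 4) (Fin 4) F) (j : Fin 4) :
    bigCellMatrix ε k l M 1 j = M 0 j ∧
    bigCellMatrix ε k l M 2 j = k * M 0 j + M 2 j ∧
    bigCellMatrix ε k l M 3 j = l * M 0 j + M 3 j := by
  refine ⟨?_, ?_, ?_⟩ <;>
    simp [bigCellMatrix, unipotentMatrix, parabolicMatrix, swapMatrix, Matrix.mul_apply,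
      Matrix.vecMul, dotProduct, Fin.sum_univ_four]

theorem bigCellFactor_apply_one (ε k l : F) (M : Matrix (Fin 4) (Fin 4) F) (j : Fin 4) :
    bigCellFactor ε k l M 1 j =
      M 0 j + (k ^ 2 - ε * l ^ 2) * M 1 j + k * M 2 j - ε * l * M 3 j := by
  simp [bigCellFactor, unipotentMatrix, parabolicMatrix, swapMatrix, Matrix.mul_apply,
      Matrix.vecMul, dotProduct, Fin.sum_univ_four]
  ring

/-- The big cell of the Bruhat decomposition. -/
def bigCellEquiv (h3 : (3 : F) = 0) {ε : F} (hε : ¬ IsSquare ε) :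
    (F × F) × ParabolicIsometry ε (-1) ≃ BigCellIsometry ε where
  toFun p := ⟨bigCellMatrix ε p.1.1 p.1.2 p.2.1,
    isometry_mul (unipotentMatrix_isometry h3 _ _ _)
      (isometry_mul (swapMatrix_isometry ε) p.2.2.1), by
      rw [bigCellMatrix, Matrix.det_mul, Matrix.det_mul, det_unipotentMatrix, det_swapMatrix,
        p.2.2.2.1]
      ring, by
      rw [(bigCellMatrix_apply _ _ _ _ _).1]
      exact left_ne_zero_of_mul_eq_one (eq_parabolicMatrix h3 hε p.2.2.1 p.2.2.2.1 p.2.2.2.2).1⟩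
  -- For M = uσP the first column is a multiple of u e₁ = (k² - εl², 1, k, l), so these ratios
  -- recover k and l. The factor P has determinant -1 because σ has.
  invFun M := ((M.1 2 0 / M.1 1 0, M.1 3 0 / M.1 1 0),
    ⟨bigCellFactor ε (M.1 2 0 / M.1 1 0) (M.1 3 0 / M.1 1 0) M.1,
      isometry_mul (swapMatrix_isometry ε)
        (isometry_mul (unipotentMatrix_isometry h3 _ _ _) M.2.1), by
      rw [bigCellFactor, Matrix.det_mul, Matrix.det_mul, det_unipotentMatrix, det_swapMatrix,
        M.2.2.1]
      ring, by
      have h00 := isometry_quaternaryForm_iff.1 M.2.1 0 0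
      simp at h00
      have hne := M.2.2.2
      rw [bigCellFactor_apply_one]
      field_simp
      -- Isotropy of the first column makes the (1,0) entry of the factor a multiple of 3.
      linear_combination 2 * h00 - M.1 0 0 * M.1 1 0 * h3⟩)
  left_inv := by
    rintro ⟨⟨k, l⟩, M, hM, hd, h10⟩
    obtain ⟨hyz, -, hP⟩ := eq_parabolicMatrix h3 hε hM hd h10
    have hy : M 0 0 ≠ 0 := left_ne_zero_of_mul_eq_one hyz
    have h20 : M 2 0 = 0 := by rw [hP]; rfl
    have h30 : M 3 0 = 0 := by rw [hP]; rfl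
    have hk : bigCellMatrix ε k l M 2 0 / bigCellMatrix ε k l M 1 0 = k := by
      rw [(bigCellMatrix_apply _ _ _ _ _).1, (bigCellMatrix_apply _ _ _ _ _).2.1, h20]
      field_simp
      ring
    have hl : bigCellMatrix ε k l M 3 0 / bigCellMatrix ε k l M 1 0 = l := by
      rw [(bigCellMatrix_apply _ _ _ _ _).1, (bigCellMatrix_apply _ _ _ _ _).2.2, h30]
      field_simp
      ring
    refine Prod.ext (Prod.ext hk hl) (Subtype.ext ?_)
    simp only [hk, hl]
    exact bigCellFactor_bigCellMatrix h3 _ _ _ _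
  right_inv M := Subtype.ext (bigCellMatrix_bigCellFactor h3 _ _ _ _)

theorem trace_parabolicMatrix (ε δ y z a b m n : F) :
    (parabolicMatrix ε δ y z a b m n).trace = y + z + a + a * δ := by
  simp [Matrix.trace, Fin.sum_univ_four, parabolicMatrix]

/-- Up to the factor y this is the norm of (m + n√ε) + (a + b√ε)(k - l√ε): the norms of the two
summands appear separately, using a² - εb² = 1, and the cross terms agree modulo 3. -/
theorem trace_bigCellMatrix (h3 : (3 : F) = 0) {ε a b : F} (hab : a ^ 2 - ε * b ^ 2 = 1)
    (k l y z m n : F) :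
    (bigCellMatrix ε k l (parabolicMatrix ε (-1) y z a b m n)).trace =
      y * ((m + (a * k - ε * b * l)) ^ 2 - ε * (n + (b * k - a * l)) ^ 2) := by
  simp [Matrix.trace, Fin.sum_univ_four, parabolicMatrix, unipotentMatrix, swapMatrix,
    bigCellMatrix]
  linear_combination -y * (k ^ 2 - ε * l ^ 2) * hab +
    y * (k * ε * n * b - k * m * a + ε * l * m * b - ε * l * n * a) * h3

end FourDim

/-! ### Numbers of isometries with prescribed trace. -/

section TraceCounts

theorem card_subtype_eq_card_and_add {α : Type*} [Finite α] (P Q : α → Prop) :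
    Nat.card {x // P x} = Nat.card {x // P x ∧ Q x} + Nat.card {x // P x ∧ ¬ Q x} := by
  classical
  have := Fintype.ofFinite α
  simp only [Nat.card_eq_fintype_card, Fintype.card_subtype, ← Finset.filter_filter]
  exact (Finset.card_filter_add_card_filter_not _).symm

theorem card_eq_sum_card_fiber {α β : Type*} [Finite α] [Fintype β] (f : α → β) :
    Nat.card α = ∑ b, Nat.card {a // f a = b} := by
  rw [← Nat.card_congr (Equiv.sigmaFiberEquiv f), Nat.card_sigma]

theorem sum_comp_eq_sum_card_fiber {α β R : Type*} [Fintype α] [Fintype β] [Semiring R]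
    (f : α → β) (g : β → R) : ∑ a, g (f a) = ∑ b, (Nat.card {a // f a = b} : R) * g b := by
  classical
  rw [← Finset.sum_fiberwise (s := univ) (g := f)]
  refine Finset.sum_congr rfl fun b _ => ?_
  rw [Nat.card_eq_fintype_card, Fintype.card_subtype, Finset.sum_congr rfl (g := fun _ => g b),
    Finset.sum_const, nsmul_eq_mul]
  intro a ha
  rw [(Finset.mem_filter.1 ha).2]

variable {F : Type*} [Field F] [Fintype F]

/-- The trace of a rotation is 2γ = -γ, and the number of points of the conic above γ is even in γ.
-/
theorem isometryCount_plane_one (h3 : (3 : F) = 0) {ε : F} (hε : ¬ IsSquare ε) (β : F) :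
    isometryCount !![1, 0; 0, -ε] 1 β + deltaOne β = 2 := by
  refine Eq.trans ?_ (card_sqrt_add_deltaOne h3 hε β)
  rw [isometryCount_plane (by simp), ← neg_sq β, ← card_normOne_fst]
  congr 1
  refine Nat.card_congr (Equiv.subtypeEquivRight fun p => ?_)
  constructor
  · intro h
    linear_combination -h + p.1.1 * h3
  · intro h
    linear_combination -h + p.1.1 * h3

theorem isometryCount_plane_neg_one [DecidableEq F] (h3 : (3 : F) = 0) {ε : F}
    (hε : ¬ IsSquare ε) (β : F) :
    isometryCount !![1, 0; 0, -ε] (-1) β = if β = 0 then Fintype.card F + 1 else 0 := by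
  rw [isometryCount_plane (by simp), ← card_normOne h3 hε]
  split_ifs with h
  · subst h
    exact Nat.card_congr (Equiv.subtypeUnivEquiv fun p => by ring)
  · have : IsEmpty {p : NormOne ε // p.1.1 + p.1.1 * -1 = β} :=
      ⟨fun p => h (by rw [← p.2]; ring)⟩
    exact Nat.card_of_isEmpty

/-- The trace is y + y⁻¹ + 2a = y + y⁻¹ - a, independent of m and n (whence q²). For each y it fixes
a, leaving 2 - δ(β - y - y⁻¹) choices of b; summing over the q - 1 units y assembles δ(2,q;β). -/
theorem card_parabolic_trace (h3 : (3 : F) = 0) {ε : F} (hε : ¬ IsSquare ε) (β : F) :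
    (Nat.card {M : ParabolicIsometry ε 1 // M.1.trace = β} : ℤ) =
      (Fintype.card F : ℤ) ^ 2 * (2 * ((Fintype.card F : ℤ) - 1) - deltaTwo β) := by
  classical
  have e1 : Nat.card {M : ParabolicIsometry ε 1 // M.1.trace = β} =
      Nat.card {p : (Fˣ × NormOne ε) × F × F // p.1.2.1.1 = (p.1.1 : F) + (p.1.1 : F)⁻¹ - β} := by
    refine (Nat.card_congr ((parabolicEquiv h3 hε (by simp)).subtypeEquiv fun p => ?_)).symm
    rw [show (parabolicEquiv h3 hε (by simp) p).1.trace = _ from trace_parabolicMatrix _ _ _ _ _ _ _ _]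
    constructor
    · intro h
      linear_combination h * 2 - β * h3 + ((p.1.1 : F) + (p.1.1 : F)⁻¹) * h3
    · intro h
      linear_combination -h + p.1.2.1.1 * h3
  have e2 : Nat.card {p : (Fˣ × NormOne ε) × F × F //
      p.1.2.1.1 = (p.1.1 : F) + (p.1.1 : F)⁻¹ - β} =
      Nat.card {p : Fˣ × NormOne ε // p.2.1.1 = (p.1 : F) + (p.1 : F)⁻¹ - β} *
        Fintype.card F ^ 2 := by
    rw [Nat.card_congr (Equiv.prodSubtypeFstEquivSubtypeProd (p := fun p : Fˣ × NormOne ε =>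
      p.2.1.1 = (p.1 : F) + (p.1 : F)⁻¹ - β)), Nat.card_prod, Nat.card_prod,
      Nat.card_eq_fintype_card (α := F), sq]
  have e3 : ∀ y : Fˣ, (Nat.card {p : NormOne ε // p.1.1 = (y : F) + (y : F)⁻¹ - β} : ℤ) =
      2 - deltaOne (β - ((y : F) + (y : F)⁻¹)) := by
    intro y
    have := card_sqrt_add_deltaOne h3 hε (β - ((y : F) + (y : F)⁻¹))
    rw [← neg_sq, ← card_normOne_fst, neg_sub] at this
    omega
  have e4 : deltaTwo β = ∑ y : Fˣ, deltaOne (β - ((y : F) + (y : F)⁻¹)) := by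
    rw [deltaTwo, card_subtype_prod]
    refine Finset.sum_congr rfl fun y _ => Nat.card_congr (Equiv.subtypeEquivRight fun z => ?_)
    rw [eq_sub_iff_add_eq', ← add_assoc]
  rw [e1, e2, card_subtype_prod]
  push_cast
  simp only [e3, Finset.sum_sub_distrib, Finset.sum_const, Finset.card_univ, nsmul_eq_mul]
  rw [e4, Fintype.card_units, Nat.cast_sub Fintype.card_pos]
  push_cast
  ring

/-- By anisotropy, β = 0 forces the zero vector with y free, while for β ≠ 0 each nonzero vector
admits exactly one y. -/
theorem card_unit_mul_norm [DecidableEq F] {ε : F} (hε : ¬ IsSquare ε) (β : F) :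
    (Nat.card {p : Fˣ × F × F // (p.1 : F) * (p.2.1 ^ 2 - ε * p.2.2 ^ 2) = β} : ℤ) =
      if β = 0 then (Fintype.card F : ℤ) - 1 else (Fintype.card F : ℤ) ^ 2 - 1 := by
  split_ifs with h
  · subst h
    have : Nat.card {p : Fˣ × F × F // (p.1 : F) * (p.2.1 ^ 2 - ε * p.2.2 ^ 2) = 0} =
        Nat.card Fˣ := by
      refine Nat.card_congr
        { toFun := fun p => p.1.1
          invFun := fun y => ⟨(y, 0, 0), by simp⟩
          left_inv := ?_
          right_inv := fun y => rfl }
      rintro ⟨⟨y, m, n⟩, h⟩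
      obtain ⟨rfl, rfl⟩ := (norm_eq_zero_iff hε).1 ((mul_eq_zero.1 h).resolve_left y.ne_zero)
      rfl
    rw [this, Nat.card_eq_fintype_card, Fintype.card_units, Nat.cast_sub Fintype.card_pos]
    simp
  · have hQ : ∀ x : {x : F × F // x ≠ 0}, x.1.1 ^ 2 - ε * x.1.2 ^ 2 ≠ 0 := by
      intro x hx
      obtain ⟨h1, h2⟩ := (norm_eq_zero_iff hε).1 hx
      exact x.2 (Prod.ext h1 h2)
    have : Nat.card {p : Fˣ × F × F // (p.1 : F) * (p.2.1 ^ 2 - ε * p.2.2 ^ 2) = β} =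
        Nat.card {x : F × F // x ≠ 0} := by
      refine Nat.card_congr
        { toFun := fun p => ⟨p.1.2, ?_⟩
          invFun := fun x => ⟨(Units.mk0 (β / (x.1.1 ^ 2 - ε * x.1.2 ^ 2)) (div_ne_zero h (hQ x)),
            x.1), div_mul_cancel₀ _ (hQ x)⟩
          left_inv := ?_
          right_inv := fun x => rfl }
      · intro hx
        apply h
        rw [← p.2, hx]
        simp
      · rintro ⟨⟨y, x⟩, hx⟩
        apply Subtype.ext
        refine Prod.ext (Units.ext ?_) rfl
        have hx0 : x.1 ^ 2 - ε * x.2 ^ 2 ≠ 0 := by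
          rintro h0
          apply h
          rw [← hx, h0, mul_zero]
        simp only [Units.val_mk0]
        rw [← hx, mul_div_cancel_right₀ _ hx0]
    rw [this, Nat.card_eq_fintype_card, Fintype.card_subtype_compl, Fintype.card_prod,
      Nat.cast_sub (by
        simpa using Nat.succ_le_of_lt (Fintype.card_pos (α := F)))]
    simp [sq]

theorem card_bigCell_trace [DecidableEq F] (h3 : (3 : F) = 0) {ε : F} (hε : ¬ IsSquare ε) (β : F) :
    (Nat.card {M : BigCellIsometry ε // M.1.trace = β} : ℤ) =
      (Fintype.card F : ℤ) ^ 2 * ((Fintype.card F : ℤ) + 1) *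
        if β = 0 then (Fintype.card F : ℤ) - 1 else (Fintype.card F : ℤ) ^ 2 - 1 := by
  -- Translating (m, n) by the shift in `trace_bigCellMatrix` makes the trace independent of (k, l)
  -- and (a, b).
  let e : ((F × F) × NormOne ε) × Fˣ × F × F ≃ BigCellIsometry ε :=
    Equiv.trans
      { toFun := fun p => (p.1.1, parabolicEquiv h3 hε (δ := -1) (by simp) ((p.2.1, p.1.2),
          p.2.2.1 - (p.1.2.1.1 * p.1.1.1 - ε * p.1.2.1.2 * p.1.1.2),
          p.2.2.2 - (p.1.2.1.2 * p.1.1.1 - p.1.2.1.1 * p.1.1.2)))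
        invFun := fun p =>
          let x := (parabolicEquiv h3 hε (δ := -1) (by simp)).symm p.2
          ((p.1, x.1.2), x.1.1, x.2.1 + (x.1.2.1.1 * p.1.1 - ε * x.1.2.1.2 * p.1.2),
            x.2.2 + (x.1.2.1.2 * p.1.1 - x.1.2.1.1 * p.1.2))
        left_inv := fun p => by
          simp only [Equiv.symm_apply_apply, sub_add_cancel]
        right_inv := fun p => by
          simp only [add_sub_cancel_right, Prod.mk.eta, Equiv.apply_symm_apply] }
      (bigCellEquiv h3 hε)
  have h1 : Nat.card {M : BigCellIsometry ε // M.1.trace = β} =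
      Nat.card {p : ((F × F) × NormOne ε) × Fˣ × F × F //
        (p.2.1 : F) * (p.2.2.1 ^ 2 - ε * p.2.2.2 ^ 2) = β} := by
    refine (Nat.card_congr (e.subtypeEquiv fun p => ?_)).symm
    have : (e p).1.trace = (p.2.1 : F) * (p.2.2.1 ^ 2 - ε * p.2.2.2 ^ 2) :=
      (trace_bigCellMatrix h3 p.1.2.2 p.1.1.1 p.1.1.2 _ _ _ _).trans
        (by simp only [sub_add_cancel])
    rw [this]
  have h2 : Nat.card {p : ((F × F) × NormOne ε) × Fˣ × F × F //
        (p.2.1 : F) * (p.2.2.1 ^ 2 - ε * p.2.2.2 ^ 2) = β} =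
      Fintype.card F ^ 2 * (Fintype.card F + 1) *
        Nat.card {p : Fˣ × F × F // (p.1 : F) * (p.2.1 ^ 2 - ε * p.2.2 ^ 2) = β} := by
    rw [card_subtype_prod]
    simp only [Finset.sum_const, Finset.card_univ, smul_eq_mul]
    rw [← card_normOne h3 hε, ← Nat.card_eq_fintype_card, Nat.card_prod, Nat.card_prod,
      Nat.card_eq_fintype_card (α := F), sq]
  rw [h1, h2]
  push_cast
  rw [card_unit_mul_norm hε]

theorem isometryCount_quaternaryForm (h3 : (3 : F) = 0) {ε : F} (hε : ¬ IsSquare ε) (β : F) :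
    (isometryCount (quaternaryForm ε) 1 β : ℤ) = traceCountFour (Fintype.card F) β := by
  classical
  have h1 : isometryCount (quaternaryForm ε) 1 β =
      Nat.card {M : ParabolicIsometry ε 1 // M.1.trace = β} +
        Nat.card {M : BigCellIsometry ε // M.1.trace = β} := by
    rw [isometryCount, card_subtype_eq_card_and_add _ fun M => M 1 0 = 0]
    congr 1
    · refine (Nat.card_congr ((Equiv.subtypeSubtypeEquivSubtypeInter (fun M =>
        Mᵀ * quaternaryForm ε * M = quaternaryForm ε ∧ M.det = 1 ∧ M 1 0 = 0)
        (fun M => M.trace = β)).trans (Equiv.subtypeEquivRight fun M => ?_))).symm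
      tauto
    · refine (Nat.card_congr ((Equiv.subtypeSubtypeEquivSubtypeInter (fun M =>
        Mᵀ * quaternaryForm ε * M = quaternaryForm ε ∧ M.det = 1 ∧ ¬ M 1 0 = 0)
        (fun M => M.trace = β)).trans (Equiv.subtypeEquivRight fun M => ?_))).symm
      tauto
  rw [h1]
  push_cast
  rw [card_parabolic_trace h3 hε, card_bigCell_trace h3 hε, traceCountFour]
  split_ifs with h
  · subst h
    ring
  · ring

end TraceCounts

/-! ### Kloosterman sums, weights and the moment recursion. -/

section Moments

variable {F : Type*} [Field F] [Fintype F] [Algebra (ZMod 3) F]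

omit [Fintype F] in
theorem three_eq_zero_of_algebra : (3 : F) = 0 := by
  have h : algebraMap (ZMod 3) F 3 = 0 := by
    rw [show (3 : ZMod 3) = 0 by decide, map_zero]
  rwa [map_ofNat] at h

-- The substitution α ↦ aα makes a² a symmetric parameter; this is why only square arguments occur.
open Classical in
theorem kloosterman_sq (a : Fˣ) :
    kloosterman (canonicalChar F) (a ^ 2) =
      ∑ α : Fˣ, canonicalChar F (a * ((α : F) + (α : F)⁻¹)) := by
  rw [kloosterman]
  refine (Fintype.sum_equiv (Equiv.mulLeft a) _ _ fun α => ?_).symm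
  congr 1
  have ha : (a : F) ≠ 0 := a.ne_zero
  have hα : (α : F) ≠ 0 := α.ne_zero
  simp only [Equiv.coe_mulLeft, Units.val_mul, Units.val_pow_eq_pow_val]
  field_simp

theorem kloosterman_sq_eq_sum_deltaOne (a : Fˣ) :
    kloosterman (canonicalChar F) (a ^ 2) =
      ∑ β : F, (deltaOne β : ℂ) * canonicalChar F (a * β) := by
  classical
  rw [kloosterman_sq, sum_comp_eq_sum_card_fiber (fun α : Fˣ => (α : F) + (α : F)⁻¹)
    (fun β => canonicalChar F (a * β))]
  rfl

theorem kloosterman_sq_sq_eq_sum_deltaTwo (a : Fˣ) :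
    kloosterman (canonicalChar F) (a ^ 2) ^ 2 =
      ∑ β : F, (deltaTwo β : ℂ) * canonicalChar F (a * β) := by
  classical
  rw [kloosterman_sq, sq, Finset.sum_mul_sum, ← Fintype.sum_prod_type']
  simp only [← AddChar.map_add_eq_mul, ← mul_add, ← add_assoc]
  rw [sum_comp_eq_sum_card_fiber
    (fun p : Fˣ × Fˣ => (p.1 : F) + (p.1 : F)⁻¹ + (p.2 : F) + (p.2 : F)⁻¹)
    (fun β => canonicalChar F (a * β))]
  rfl

theorem sum_canonicalChar_unit_mul (a : Fˣ) : ∑ β : F, canonicalChar F (a * β) = 0 := by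
  simp only [mul_comm (a : F)]
  rw [sum_canonicalChar_mul, if_neg a.ne_zero]

-- On the prime field, three times the indicator of x ≠ 0 is 2 - ψ(x) - ψ(-x).
omit [Fintype F] in
theorem three_mul_traceWeight {N : ℕ} (v : Fin N → F) (a : F) :
    3 * (traceWeight v a : ℂ) = 2 * N - (∑ i, canonicalChar F (a * v i)) -
      ∑ i, canonicalChar F (-a * v i) := by
  classical
  have h1 : ∀ x : ZMod 3, (3 : ℂ) * (if x ≠ 0 then 1 else 0) =
      2 - ZMod.stdAddChar (N := 3) x - ZMod.stdAddChar (N := 3) (-x) := by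
    intro x
    have h := sum_stdAddChar_three_mul x
    have h3 : ∑ s : ZMod 3, ZMod.stdAddChar (N := 3) (s * x) =
        ZMod.stdAddChar (N := 3) (0 * x) + ZMod.stdAddChar (N := 3) (1 * x) +
          ZMod.stdAddChar (N := 3) (-1 * x) := Fin.sum_univ_three _
    rw [h3, zero_mul, one_mul, neg_one_mul, AddChar.map_zero_eq_one] at h
    by_cases hx : x = 0
    · simp [hx]
      norm_num
    · rw [if_neg hx] at h
      rw [if_pos hx]
      linear_combination h
  have h2 : (traceWeight v a : ℂ) =
      ∑ i, if Algebra.trace (ZMod 3) F (a * v i) ≠ 0 then (1 : ℂ) else 0 := by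
    rw [traceWeight, hammingNorm, Finset.sum_boole]
  rw [h2, Finset.mul_sum, Finset.sum_congr rfl fun i _ => h1 _, Finset.sum_sub_distrib,
    Finset.sum_sub_distrib]
  simp only [canonicalChar_apply, neg_mul, map_neg, Finset.sum_const, Finset.card_univ,
    Fintype.card_fin, nsmul_eq_mul]
  ring

omit [Algebra (ZMod 3) F] in
open Classical in
theorem sum_units_sq (h2 : (2 : F) ≠ 0) (g : Fˣ → ℂ) :
    ∑ a : Fˣ, g (a ^ 2) = 2 * ∑ b ∈ (univ : Finset Fˣ).filter (fun b : Fˣ => IsSquare (b : F)),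
      g b := by
  rw [sum_comp_eq_sum_card_fiber (fun a : Fˣ => a ^ 2) g, Finset.sum_filter, Finset.mul_sum]
  refine Finset.sum_congr rfl fun b _ => ?_
  split_ifs with hb
  · congr 1
    obtain ⟨c, hc⟩ := hb
    have hc0 : c ≠ 0 := by
      rintro rfl
      exact b.ne_zero (by rw [hc, mul_zero])
    have hne : Units.mk0 c hc0 ≠ -Units.mk0 c hc0 := by
      intro h
      have h' := congr_arg Units.val h
      simp only [Units.val_mk0, Units.val_neg] at h'
      exact mul_ne_zero h2 hc0 (by linear_combination h')
    have : (univ.filter fun a : Fˣ => a ^ 2 = b) = {Units.mk0 c hc0, -Units.mk0 c hc0} := by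
      ext a
      simp only [Finset.mem_filter, Finset.mem_univ, true_and, Finset.mem_insert,
        Finset.mem_singleton, Units.ext_iff, Units.val_pow_eq_pow_val, Units.val_mk0,
        Units.val_neg, hc]
      rw [← sq, sq_eq_sq_iff_eq_or_eq_neg]
    rw [Nat.card_eq_fintype_card, Fintype.card_subtype, this, Finset.card_pair hne]
    norm_num
  · have : IsEmpty {a : Fˣ // a ^ 2 = b} := ⟨fun a => hb ⟨a.1, by
      have := congr_arg Units.val a.2
      rw [← this, Units.val_pow_eq_pow_val, sq]⟩⟩
    rw [Nat.card_of_isEmpty]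
    simp

omit [Algebra (ZMod 3) F] in
open Classical in
theorem sum_eq_zero_add_sum_units (g : F → ℂ) : ∑ a : F, g a = g 0 + ∑ a : Fˣ, g a := by
  classical
  rw [Fintype.sum_eq_add_sum_compl 0]
  congr 1
  have h := Fintype.sum_equiv (unitsEquivNeZero (G₀ := F)) (fun a => g a) (fun a => g a)
    fun a => rfl
  rw [h]
  exact Finset.sum_subtype _ (by simp) _

/-- The moment recursion given by a code whose weights are affine in powers of Kloosterman sums. -/
theorem squareMoment_recursion {N : ℕ} (v : Fin N → F)
    (C' : Submodule (ZMod 3) (Fin N → ZMod 3))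
    (hC : ∀ u, u ∈ C' ↔ ∑ i, algebraMap (ZMod 3) F (u i) * v i = 0) (s A : ℂ) (hs : s ≠ 0) (k : ℕ)
    (hE : ∀ a : Fˣ, ∑ i, canonicalChar F (a * v i) =
      N - s * (A + kloosterman (canonicalChar F) (a ^ 2) ^ k)) {h : ℕ} (hh : 1 ≤ h) :
    squareMoment F (k * h) =
      -(∑ j ∈ range h, (h.choose j : ℂ) * A ^ (h - j) * squareMoment F (k * j)) +
        (Fintype.card F : ℂ) / s ^ h * weightSum N h (weightDist C') := by
  classical
  have h3 : (3 : F) = 0 := three_eq_zero_of_algebra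
  have h2 : (2 : F) ≠ 0 := by
    intro h
    exact one_ne_zero (α := F) (by linear_combination h3 - h)
  -- The character sums at a and -a agree, depending only on a², and the length N cancels.
  have hw : ∀ a : Fˣ, (traceWeight v (a : F) : ℂ) =
      2 / 3 * s * (A + kloosterman (canonicalChar F) (a ^ 2) ^ k) := by
    intro a
    have e1 := three_mul_traceWeight v (a : F)
    have e2 := hE (-a)
    rw [Units.val_neg, neg_sq] at e2
    rw [hE, e2] at e1
    linear_combination e1 / 3
  have hw0 : traceWeight v 0 = 0 := by
    rw [traceWeight, hammingNorm_eq_zero]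
    ext i
    simp
  have key := sum_traceWeight_pow v C' hC h
  -- The term a = 0 is 0^h, which vanishes because h ≥ 1.
  rw [sum_eq_zero_add_sum_units, hw0, Nat.cast_zero, zero_pow (by omega), zero_add] at key
  simp only [hw] at key
  rw [sum_units_sq h2 fun b => (2 / 3 * s * (A + kloosterman (canonicalChar F) b ^ k)) ^ h] at key
  simp only [mul_pow _ _ h, ← Finset.mul_sum] at key
  have hsum : (∑ b ∈ (univ : Finset Fˣ).filter (fun b : Fˣ => IsSquare (b : F)),
      (A + kloosterman (canonicalChar F) b ^ k) ^ h) =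
      ∑ j ∈ range (h + 1), (h.choose j : ℂ) * A ^ (h - j) * squareMoment F (k * j) := by
    simp only [squareMoment, Finset.mul_sum]
    rw [Finset.sum_comm]
    refine Finset.sum_congr ?_ fun b _ => ?_
    · congr
    · rw [add_comm, add_pow]
      refine Finset.sum_congr rfl fun j _ => ?_
      rw [pow_mul]
      ring
  rw [hsum, Finset.sum_range_succ, Nat.choose_self, Nat.sub_self] at key
  have hsh : s ^ h ≠ 0 := pow_ne_zero _ hs
  have h23 : ((2 : ℂ) / 3) ^ h ≠ 0 := pow_ne_zero _ (by norm_num)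
  have hs2 : s ^ h * (∑ j ∈ range h, (h.choose j : ℂ) * A ^ (h - j) * squareMoment F (k * j) +
      squareMoment F (k * h)) = (Fintype.card F : ℂ) * weightSum N h (weightDist C') := by
    apply mul_left_cancel₀ (mul_ne_zero two_ne_zero h23)
    linear_combination key
  field_simp
  linear_combination hs2

end Moments

/-! ### The codes of the orthogonal groups. -/

section GroupCodes

variable {F : Type*} [Field F] [Fintype F]

instance isEmpty_fin_one_sub_one : IsEmpty (Fin (1 - 1)) := inferInstanceAs (IsEmpty (Fin 0))

omit [Fintype F] in
theorem isometryCount_minusForm_one (ε d β : F) :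
    isometryCount (minusForm 1 ε) d β = isometryCount !![1, 0; 0, -ε] d β := by
  let e : MinusIndex 1 ≃ Fin 2 := Equiv.emptySum (Fin (1 - 1) ⊕ Fin (1 - 1)) (Fin 2)
  rw [← isometryCount_reindex e]
  congr 1

omit [Fintype F] in
theorem isometryCount_minusForm_two (ε d β : F) :
    isometryCount (minusForm 2 ε) d β = isometryCount (quaternaryForm ε) d β := by
  let e : MinusIndex 2 ≃ Fin 4 :=
    (Equiv.sumCongr (finSumFinEquiv (m := 1) (n := 1)) (Equiv.refl (Fin 2))).trans
      (finSumFinEquiv (m := 2) (n := 2))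
  rw [← isometryCount_reindex e.symm (quaternaryForm ε)]
  congr 1
  ext i j
  rcases i with (i | i) | i <;> rcases j with (j | j) | j <;> fin_cases i <;> fin_cases j <;> rfl

omit [Fintype F] in
theorem det_minusForm_one (ε : F) : (minusForm 1 ε).det = -ε := by
  rw [minusForm, Matrix.det_fromBlocks_zero₁₂, Matrix.det_isEmpty, Matrix.det_fin_two_of]
  ring

variable [Algebra (ZMod 3) F] {m : Type*} [Fintype m] [DecidableEq m] {G : Subgroup (GL m F)}
  (e : Fin (Nat.card G) ≃ G)

omit [Fintype F] [Algebra (ZMod 3) F] in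
theorem card_listing_trace (β : F) : Nat.card {i // Matrix.trace ((e i : GL m F) : Matrix m m F) = β} =
    Nat.card {w : G // Matrix.trace ((w : GL m F) : Matrix m m F) = β} :=
  Nat.card_congr (e.subtypeEquiv fun _ => Iff.rfl)

-- The set T may be any set containing all traces that occur, which allows the index sets built from
-- D in dimension two.
omit [Fintype F] in
theorem weightDist_groupCode (T : Finset F) [DecidableEq F] (n : F → ℤ)
    (hn : ∀ β, (Nat.card {w : G // Matrix.trace ((w : GL m F) : Matrix m m F) = β} : ℤ) =
      if β ∈ T then n β else 0) (j : ℕ) :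
    weightDist (groupCode G e) j = trinomialSum T n j := by
  refine card_orthogonal_words (fun i => Matrix.trace ((e i : GL m F) : Matrix m m F)) T n ?_ ?_ j
  · intro i
    by_contra hi
    have h := hn (Matrix.trace ((e i : GL m F) : Matrix m m F))
    rw [if_neg hi, ← card_listing_trace e] at h
    have : Nonempty {k // Matrix.trace ((e k : GL m F) : Matrix m m F) =
      Matrix.trace ((e i : GL m F) : Matrix m m F)} := ⟨⟨i, rfl⟩⟩
    have h0 := Nat.card_pos (α := {k // Matrix.trace ((e k : GL m F) : Matrix m m F) =
      Matrix.trace ((e i : GL m F) : Matrix m m F)})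
    omega
  · intro β hβ
    have h := hn β
    rw [if_pos hβ, ← card_listing_trace e] at h
    exact h.symm

theorem sum_canonicalChar_trace (a : F) :
    ∑ i, canonicalChar F (a * Matrix.trace ((e i : GL m F) : Matrix m m F)) =
      ∑ β : F, (Nat.card {w : G // Matrix.trace ((w : GL m F) : Matrix m m F) = β} : ℂ) *
        canonicalChar F (a * β) := by
  rw [sum_comp_eq_sum_card_fiber (fun i => Matrix.trace ((e i : GL m F) : Matrix m m F))
    fun β => canonicalChar F (a * β)]
  simp only [card_listing_trace e]

theorem squareMoment_eq_of_groupCode (s A : ℂ) (hs : s ≠ 0) (k : ℕ)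
    (hE : ∀ a : Fˣ, ∑ β : F, (Nat.card {w : G // Matrix.trace ((w : GL m F) : Matrix m m F) = β} : ℂ) *
        canonicalChar F (a * β) =
      Nat.card G - s * (A + kloosterman (canonicalChar F) (a ^ 2) ^ k)) {h : ℕ} (hh : 1 ≤ h) :
    squareMoment F (k * h) =
      -(∑ j ∈ range h, (h.choose j : ℂ) * A ^ (h - j) * squareMoment F (k * j)) +
        (Fintype.card F : ℂ) / s ^ h * weightSum (Nat.card G) h (weightDist (groupCode G e)) :=
  squareMoment_recursion (fun i => Matrix.trace ((e i : GL m F) : Matrix m m F)) (groupCode G e)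
    (fun _ => Iff.rfl) s A hs k (fun a => by rw [sum_canonicalChar_trace, hE]) hh

end GroupCodes

/-! ### Trace distributions, orders and exponential sums of the three groups. -/

section Distributions

variable {F : Type*} [Field F] [Fintype F]

theorem card_SOMinus_one_trace (h3 : (3 : F) = 0) {ε : F} (hε : ¬ IsSquare ε) (β : F) :
    Nat.card {w : SOMinus 1 ε // Matrix.trace ((w : GL (MinusIndex 1) F) :
      Matrix (MinusIndex 1) (MinusIndex 1) F) = β} + deltaOne β = 2 := by
  rw [card_SOMinus_trace, isometryCount_minusForm_one, isometryCount_plane_one h3 hε]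

theorem card_OMinus_one_trace [DecidableEq F] (h3 : (3 : F) = 0) {ε : F} (hε : ¬ IsSquare ε)
    (β : F) : Nat.card {w : OMinus 1 ε // Matrix.trace ((w : GL (MinusIndex 1) F) :
      Matrix (MinusIndex 1) (MinusIndex 1) F) = β} + deltaOne β =
        2 + if β = 0 then Fintype.card F + 1 else 0 := by
  have hε0 : ε ≠ 0 := by rintro rfl; exact hε IsSquare.zero
  have h2 : (2 : F) ≠ 0 := by
    intro h
    exact one_ne_zero (α := F) (by linear_combination h3 - h)
  rw [card_OMinus_trace 1 ε β h2 (by rw [det_minusForm_one]; exact neg_ne_zero.2 hε0),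
    isometryCount_minusForm_one, isometryCount_minusForm_one, isometryCount_plane_neg_one h3 hε]
  linarith [isometryCount_plane_one h3 hε β]

theorem card_SOMinus_two_trace (h3 : (3 : F) = 0) {ε : F} (hε : ¬ IsSquare ε) (β : F) :
    (Nat.card {w : SOMinus 2 ε // Matrix.trace ((w : GL (MinusIndex 2) F) :
      Matrix (MinusIndex 2) (MinusIndex 2) F) = β} : ℤ) = traceCountFour (Fintype.card F) β := by
  rw [card_SOMinus_trace, isometryCount_minusForm_two, isometryCount_quaternaryForm h3 hε]

theorem card_SOMinus_one (h3 : (3 : F) = 0) {ε : F} (hε : ¬ IsSquare ε) :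
    Nat.card (SOMinus 1 ε) = Fintype.card F + 1 := by
  rw [card_eq_sum_card_fiber fun w : SOMinus 1 ε => Matrix.trace ((w : GL (MinusIndex 1) F) :
    Matrix (MinusIndex 1) (MinusIndex 1) F)]
  have h := Finset.sum_congr rfl fun β (_ : β ∈ (univ : Finset F)) => card_SOMinus_one_trace h3 hε β
  rw [Finset.sum_add_distrib, Finset.sum_const, Finset.card_univ, smul_eq_mul] at h
  have := sum_deltaOne (F := F)
  omega

theorem card_OMinus_one (h3 : (3 : F) = 0) {ε : F} (hε : ¬ IsSquare ε) :
    Nat.card (OMinus 1 ε) = 2 * (Fintype.card F + 1) := by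
  classical
  rw [card_eq_sum_card_fiber fun w : OMinus 1 ε => Matrix.trace ((w : GL (MinusIndex 1) F) :
    Matrix (MinusIndex 1) (MinusIndex 1) F)]
  have h := Finset.sum_congr rfl fun β (_ : β ∈ (univ : Finset F)) => card_OMinus_one_trace h3 hε β
  rw [Finset.sum_add_distrib, Finset.sum_add_distrib, Finset.sum_const, Finset.card_univ,
    smul_eq_mul, Finset.sum_ite_eq' univ (0 : F), if_pos (Finset.mem_univ _)] at h
  have := sum_deltaOne (F := F)
  omega

theorem sum_deltaTwo : ∑ β : F, (deltaTwo β : ℤ) = ((Fintype.card F : ℤ) - 1) ^ 2 := by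
  classical
  have h := card_eq_sum_card_fiber fun p : Fˣ × Fˣ =>
    (p.1 : F) + (p.1 : F)⁻¹ + (p.2 : F) + (p.2 : F)⁻¹
  rw [Nat.card_prod, Nat.card_eq_fintype_card, Fintype.card_units] at h
  have h' := congr_arg (Nat.cast : ℕ → ℤ) h
  rw [Nat.cast_mul, Nat.cast_sub Fintype.card_pos, Nat.cast_one, Nat.cast_sum] at h'
  rw [sq]
  exact h'.symm

-- Separates the correction at β = 0 from a formula uniform in β, so that the constant part
-- disappears when summed against a nontrivial character.
omit [Fintype F] in
theorem traceCountFour_eq [DecidableEq F] (q : ℕ) (β : F) : traceCountFour q β =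
    -(q : ℤ) ^ 2 * deltaTwo β + ((q : ℤ) ^ 5 + (q : ℤ) ^ 4 + (q : ℤ) ^ 3 - 3 * (q : ℤ) ^ 2) +
      if β = 0 then (q : ℤ) ^ 3 - (q : ℤ) ^ 5 else 0 := by
  rw [traceCountFour]
  split_ifs with h
  · rw [h]
    ring
  · ring

theorem card_SOMinus_two (h3 : (3 : F) = 0) {ε : F} (hε : ¬ IsSquare ε) :
    (Nat.card (SOMinus 2 ε) : ℤ) = (Fintype.card F : ℤ) ^ 2 * ((Fintype.card F : ℤ) ^ 4 - 1) := by
  classical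
  rw [card_eq_sum_card_fiber fun w : SOMinus 2 ε => Matrix.trace ((w : GL (MinusIndex 2) F) :
    Matrix (MinusIndex 2) (MinusIndex 2) F)]
  push_cast
  simp only [card_SOMinus_two_trace h3 hε, traceCountFour_eq, Finset.sum_add_distrib,
    ← Finset.mul_sum, sum_deltaTwo, Finset.sum_ite_eq', Finset.mem_univ, if_true, Finset.sum_const,
    Finset.card_univ, nsmul_eq_mul]
  ring

variable [Algebra (ZMod 3) F]

theorem sum_card_SOMinus_one_trace {ε : F} (hε : ¬ IsSquare ε) (a : Fˣ) :
    ∑ β : F, (Nat.card {w : SOMinus 1 ε // Matrix.trace ((w : GL (MinusIndex 1) F) :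
      Matrix (MinusIndex 1) (MinusIndex 1) F) = β} : ℂ) * canonicalChar F (a * β) =
      -kloosterman (canonicalChar F) (a ^ 2) := by
  have h : ∀ β : F, (Nat.card {w : SOMinus 1 ε // Matrix.trace ((w : GL (MinusIndex 1) F) :
      Matrix (MinusIndex 1) (MinusIndex 1) F) = β} : ℂ) = 2 - deltaOne β := by
    intro β
    rw [eq_sub_iff_add_eq]
    exact_mod_cast card_SOMinus_one_trace three_eq_zero_of_algebra hε β
  simp only [h, sub_mul, Finset.sum_sub_distrib, ← Finset.mul_sum, sum_canonicalChar_unit_mul,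
    kloosterman_sq_eq_sum_deltaOne]
  ring

theorem sum_card_OMinus_one_trace {ε : F} (hε : ¬ IsSquare ε) (a : Fˣ) :
    ∑ β : F, (Nat.card {w : OMinus 1 ε // Matrix.trace ((w : GL (MinusIndex 1) F) :
      Matrix (MinusIndex 1) (MinusIndex 1) F) = β} : ℂ) * canonicalChar F (a * β) =
      Fintype.card F + 1 - kloosterman (canonicalChar F) (a ^ 2) := by
  classical
  have h : ∀ β : F, (Nat.card {w : OMinus 1 ε // Matrix.trace ((w : GL (MinusIndex 1) F) :
      Matrix (MinusIndex 1) (MinusIndex 1) F) = β} : ℂ) =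
        2 - deltaOne β + if β = 0 then (Fintype.card F : ℂ) + 1 else 0 := by
    intro β
    have := congr_arg (Nat.cast : ℕ → ℂ) (card_OMinus_one_trace three_eq_zero_of_algebra hε β)
    push_cast at this
    linear_combination this
  simp only [h, add_mul, sub_mul, Finset.sum_add_distrib, Finset.sum_sub_distrib, ← Finset.mul_sum,
    sum_canonicalChar_unit_mul, kloosterman_sq_eq_sum_deltaOne, ite_mul, zero_mul,
    Finset.sum_ite_eq', Finset.mem_univ, if_true, mul_zero, AddChar.map_zero_eq_one]
  ring

theorem sum_card_SOMinus_two_trace {ε : F} (hε : ¬ IsSquare ε) (a : Fˣ) :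
    ∑ β : F, (Nat.card {w : SOMinus 2 ε // Matrix.trace ((w : GL (MinusIndex 2) F) :
      Matrix (MinusIndex 2) (MinusIndex 2) F) = β} : ℂ) * canonicalChar F (a * β) =
      (Fintype.card F : ℂ) ^ 3 - (Fintype.card F : ℂ) ^ 5 -
        (Fintype.card F : ℂ) ^ 2 * kloosterman (canonicalChar F) (a ^ 2) ^ 2 := by
  classical
  have h : ∀ β : F, (Nat.card {w : SOMinus 2 ε // Matrix.trace ((w : GL (MinusIndex 2) F) :
      Matrix (MinusIndex 2) (MinusIndex 2) F) = β} : ℂ) =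
        -(Fintype.card F : ℂ) ^ 2 * deltaTwo β + ((Fintype.card F : ℂ) ^ 5 +
          (Fintype.card F : ℂ) ^ 4 + (Fintype.card F : ℂ) ^ 3 - 3 * (Fintype.card F : ℂ) ^ 2) +
          if β = 0 then (Fintype.card F : ℂ) ^ 3 - (Fintype.card F : ℂ) ^ 5 else 0 := by
    intro β
    have := congr_arg (Int.cast : ℤ → ℂ) ((card_SOMinus_two_trace three_eq_zero_of_algebra hε β).trans
      (traceCountFour_eq _ β))
    push_cast at this
    exact this
  simp only [h, add_mul, Finset.sum_add_distrib, mul_assoc, ← Finset.mul_sum,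
    sum_canonicalChar_unit_mul, kloosterman_sq_sq_eq_sum_deltaTwo, ite_mul, zero_mul,
    Finset.sum_ite_eq', Finset.mem_univ, if_true, mul_zero, AddChar.map_zero_eq_one]
  ring

end Distributions

/-! ### The recursions and weight distributions. -/

theorem theorem1 {F : Type*} [Field F] [Fintype F] [DecidableEq F] [Algebra (ZMod 3) F]
    (r q : ℕ) (hq : q = 3 ^ r) (hF : Fintype.card F = q) (ε : F) (hε : ¬ IsSquare ε)
    (e₁ : Fin (Nat.card (SOMinus 1 ε)) ≃ SOMinus 1 ε)
    (e₂ : Fin (Nat.card (OMinus 1 ε)) ≃ OMinus 1 ε)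
    (e₃ : Fin (Nat.card (SOMinus 2 ε)) ≃ SOMinus 2 ε) :
    -- part (1)
    (Nat.card (SOMinus 1 ε) = q + 1 ∧
      (∀ h : ℕ, 1 ≤ h →
        squareMoment F h =
          -(∑ j ∈ Finset.range h, (h.choose j : ℂ) * ((q : ℂ) + 1) ^ (h - j) * squareMoment F j)
          + (q : ℂ) * weightSum (Nat.card (SOMinus 1 ε)) h
              (weightDist (groupCode (SOMinus 1 ε) e₁))) ∧
      (∀ j : ℕ, j ≤ Nat.card (SOMinus 1 ε) →
        weightDist (groupCode (SOMinus 1 ε) e₁) j =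
          trinomialSum ({1, -1} ∪ nonsquareSet F)
            (fun β => if β = 1 ∨ β = -1 then 1 else 2) j)) ∧
    -- part (2)
    (Nat.card (OMinus 1 ε) = 2 * (q + 1) ∧
      (∀ h : ℕ, 1 ≤ h →
        squareMoment F h =
          -(∑ j ∈ Finset.range h, (h.choose j : ℂ) * ((q : ℂ) + 1) ^ (h - j) * squareMoment F j)
          + (q : ℂ) * weightSum (Nat.card (OMinus 1 ε)) h
              (weightDist (groupCode (OMinus 1 ε) e₂))) ∧
      (Even r → ∀ j : ℕ, j ≤ Nat.card (OMinus 1 ε) →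
        weightDist (groupCode (OMinus 1 ε) e₂) j =
          trinomialSum ({0, 1, -1} ∪ nonsquareSet F)
            (fun β => if β = 0 then (q : ℤ) + 1 else if β = 1 ∨ β = -1 then 1 else 2) j) ∧
      (Odd r → ∀ j : ℕ, j ≤ Nat.card (OMinus 1 ε) →
        weightDist (groupCode (OMinus 1 ε) e₂) j =
          trinomialSum ({0, 1, -1} ∪ (nonsquareSet F).filter (fun β => β ^ 2 - 1 ≠ -1))
            (fun β => if β = 0 then (q : ℤ) + 3 else if β = 1 ∨ β = -1 then 1 else 2) j)) ∧
    -- part (3)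
    (Nat.card (SOMinus 2 ε) = q ^ 2 * (q ^ 4 - 1) ∧
      (∀ h : ℕ, 1 ≤ h →
        squareMoment F (2 * h) =
          -(∑ j ∈ Finset.range h, (h.choose j : ℂ) *
              ((q : ℂ) ^ 4 + (q : ℂ) ^ 3 - (q : ℂ) - 1) ^ (h - j) * squareMoment F (2 * j))
          + (q : ℂ) ^ (1 - 2 * (h : ℤ)) * weightSum (Nat.card (SOMinus 2 ε)) h
              (weightDist (groupCode (SOMinus 2 ε) e₃))) ∧
      (∀ β : F, 0 ≤ traceCountFour q β) ∧
      (∀ j : ℕ, j ≤ Nat.card (SOMinus 2 ε) →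
        weightDist (groupCode (SOMinus 2 ε) e₃) j =
          trinomialSum (Finset.univ : Finset F) (traceCountFour q) j)) := by
  classical
  have h3 : (3 : F) = 0 := three_eq_zero_of_algebra
  have h01 : (0 : F) ≠ 1 := zero_ne_one
  have h0n1 : (0 : F) ≠ -1 := (neg_ne_zero.2 one_ne_zero).symm
  have hmem : ∀ β : F, β ∈ nonsquareSet F ↔ ¬ IsSquare (β ^ 2 - 1) := by
    intro β
    simp [nonsquareSet]
  have hcard : (Fintype.card F : ℂ) = q := by rw [hF]
  have hq0 : (q : ℂ) ≠ 0 := by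
    rw [← hcard]
    exact_mod_cast Fintype.card_ne_zero
  have hneg : IsSquare (-1 : F) ↔ 3 ^ r % 4 ≠ 3 := by
    rw [FiniteField.isSquare_neg_one_iff, hF, hq]
  have hN1 : (Nat.card (SOMinus 1 ε) : ℂ) = q + 1 := by
    rw [card_SOMinus_one h3 hε, hF]
    push_cast
    ring
  have hN2 : (Nat.card (OMinus 1 ε) : ℂ) = 2 * (q + 1) := by
    rw [card_OMinus_one h3 hε, hF]
    push_cast
    ring
  have hN3 : (Nat.card (SOMinus 2 ε) : ℂ) = (q : ℂ) ^ 2 * ((q : ℂ) ^ 4 - 1) := by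
    have := congr_arg (Int.cast : ℤ → ℂ) (card_SOMinus_two h3 hε)
    rw [hF] at this
    push_cast at this
    exact this
  refine ⟨⟨?_, ?_, ?_⟩, ⟨?_, ?_, ?_, ?_⟩, ?_, ?_, ?_, ?_⟩
  · rw [card_SOMinus_one h3 hε, hF]
  · intro h hh
    have := squareMoment_eq_of_groupCode e₁ 1 ((q : ℂ) + 1) one_ne_zero 1 (fun a => by
      rw [sum_card_SOMinus_one_trace hε, hN1]
      ring) hh
    simpa only [one_mul, one_pow, div_one, hcard] using this
  · intro j _
    refine weightDist_groupCode e₁ _ _ (fun β => ?_) j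
    have h := card_SOMinus_one_trace h3 hε β
    rw [deltaOne_eq_ite h3] at h
    simp only [Finset.mem_union, Finset.mem_insert, Finset.mem_singleton, hmem]
    split_ifs at h ⊢ <;> first | omega | tauto
  · rw [card_OMinus_one h3 hε, hF]
  · intro h hh
    have := squareMoment_eq_of_groupCode e₂ 1 ((q : ℂ) + 1) one_ne_zero 1 (fun a => by
      rw [sum_card_OMinus_one_trace hε, hN2, hcard]
      ring) hh
    simpa only [one_mul, one_pow, div_one, hcard] using this
  · intro hr j _
    refine weightDist_groupCode e₂ _ _ (fun β => ?_) j
    have h := card_OMinus_one_trace h3 hε β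
    rw [deltaOne_eq_ite h3, hF] at h
    simp only [Finset.mem_union, Finset.mem_insert, Finset.mem_singleton, hmem]
    by_cases hβ : β = 0
    · have hs : IsSquare ((0 : F) ^ 2 - 1) := by
        rw [zero_pow two_ne_zero, zero_sub, hneg]
        obtain ⟨k, rfl⟩ := hr
        rw [← two_mul, pow_mul, Nat.pow_mod]
        simp
      simp only [hs, if_true, hβ, h01, h0n1, or_self, if_false, true_or] at h ⊢
      omega
    · simp only [hβ, if_false, false_or] at h ⊢
      split_ifs at h ⊢ <;> first | omega | tauto
  · intro hr j _
    refine weightDist_groupCode e₂ _ _ (fun β => ?_) j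
    have h := card_OMinus_one_trace h3 hε β
    rw [deltaOne_eq_ite h3, hF] at h
    simp only [Finset.mem_union, Finset.mem_insert, Finset.mem_singleton, Finset.mem_filter, hmem]
    by_cases hβ : β = 0
    · have hs : ¬ IsSquare ((0 : F) ^ 2 - 1) := by
        rw [zero_pow two_ne_zero, zero_sub, hneg, not_not]
        obtain ⟨k, rfl⟩ := hr
        rw [pow_add, pow_mul, Nat.mul_mod, Nat.pow_mod]
        simp
      simp only [hs, if_true, hβ, h01, h0n1, or_self, if_false, true_or] at h ⊢
      omega
    · have hβ' : β ^ 2 - 1 ≠ -1 := fun h => hβ (pow_eq_zero_iff two_ne_zero |>.1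
        (by linear_combination h))
      simp only [hβ, if_false, false_or, hβ', ne_eq, not_false_eq_true, and_true] at h ⊢
      split_ifs at h ⊢ <;> first | omega | tauto
  · have h1 : 1 ≤ q ^ 4 := Nat.one_le_pow _ _ (by rw [hq]; positivity)
    have := card_SOMinus_two h3 hε
    rw [hF] at this
    zify [h1]
    exact this
  · intro h hh
    have := squareMoment_eq_of_groupCode e₃ ((q : ℂ) ^ 2) ((q : ℂ) ^ 4 + (q : ℂ) ^ 3 - q - 1)
      (pow_ne_zero _ hq0) 2 (fun a => by
        rw [sum_card_SOMinus_two_trace hε, hN3, hcard]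
        ring) hh
    rw [this, hcard]
    congr 2
    rw [zpow_sub₀ hq0, zpow_one, ← pow_mul]
    norm_cast
  · intro β
    -- Nonnegativity holds because these integers count group elements.
    rw [← hF, ← card_SOMinus_two_trace h3 hε]
    exact Int.natCast_nonneg _
  · intro j _
    refine weightDist_groupCode e₃ _ _ (fun β => ?_) j
    rw [if_pos (Finset.mem_univ _), card_SOMinus_two_trace h3 hε, hF]
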